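/- Let $\mathcal X,\mathcal Y$ be finite alphabets, $P_{Y|X}$ a channel from $\mathcal X$ to $\mathcal Y$ and $Q_Y$ a distribution on $\mathcal Y$. Assume that the set $\mathcal P(P_{Y|X},Q_Y):=\{P_X:\ \sum_xP_X(x)P_{Y|X}(\cdot|x)=Q_Y\}$ of input distributions inducing $Q_Y$ is nonempty. All logarithms are natural. For distributions $P,Q$ on a finite set put $D(P\|Q)=\sum_xP(x)\log\frac{P(x)}{Q(x)}$, $D_1=D$, and for $s\ge-1$, $s\ne0$, $$D_{1+s}(P\|Q)=\frac1s\log\sum_xP(x)^{1+s}Q(x)^{-s},$$ with values in $[-\infty,\infty]$, where $0\cdot\infty=0$, $\log0=-\infty$, and $t^0=1$ for all $t\ge 0$. For a blocklength $n\ge1$ and a rate $R>0$ let $M_n=\lceil e^{nR}\rceil$. A random mapping $f_{U_n}$ consists of a random variable $U_n$ with values in a finite set and, for each value $u$, a map $f_u=(f_{u,1},\dots,f_{u,n}):\{1,\dots,M_n\}\to\mathcal X^n$. The message is uniform on $\{1,\dots,M_n\}$ and independent of $U_n$, and the output distribution given $U_n=u$ is $$P_{Y^n|U_n}(y^n|u)=\frac1{M_n}\sum_{m=1}^{M_n}\prod_{i=1}^nP_{Y|X}(y_i|f_{u,i}(m)).$$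 Let $Q_{Y^n}=Q_Y^{n}$ be the $n$-fold product distribution, and for $s\in[-1,1]$ let $$R^*_{1+s}:=\inf\Big\{R>0:\ \tfrac1n\inf_{f_{U_n}}D_{1+s}\big(P_{Y^nU_n}\,\big\|\,Q_{Y^n}P_{U_n}\big)\to0\text{ as }n\to\infty\Big\},$$ the inner infimum being over all random mappings. Then: 1. for $s\in(0,1]$, $\displaystyle R^*_{1+s}=\min_{P_X\in\mathcal P(P_{Y|X},Q_Y)}\sum_xP_X(x)\,D_{1+s}\big(P_{Y|X}(\cdot|x)\,\big\|\,Q_Y\big)$; 2. for $s\in(-1,0]$, $\displaystyle R^*_{1+s}=\min_{P_X\in\mathcal P(P_{Y|X},Q_Y)}\sum_xP_X(x)\,D\big(P_{Y|X}(\cdot|x)\,\big\|\,Q_Y\big)=\min_{P_X\in\mathcal P(P_{Y|X},Q_Y)}I(X;Y)$, where $(X,Y)\sim P_XP_{Y|X}$; 3. for $s=-1$, $R^*_{0}=0$. If moreover $D_0$ is replaced by its variant $D_0^{\mathrm{supp}}(P\|Q):=-\log\sum_{x:P(x)>0}Q(x)$ (which corresponds to the convention $0^0=0$), then the corresponding infimum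 of rates equals $0$ if and only if there is an $x\in\mathcal X$ such that $P_{Y|X}(y|x)>0$ for every $y$ with $Q_Y(y)>0$. In all cases the set of rates is nonempty and the infima and minima are finite; all the minima are attained. -/

import Mathlib

open Filter Topology
open scoped ENNReal

noncomputable section

universe u v w

/-- The product distribution `y ↦ ∏ i, p i (y i)` on sequences of length `n`. -/
def productPMF {Y : Type v} [Fintype Y] {n : ℕ} (p : Fin n → PMF Y) : PMF (Fin n → Y) :=
  PMF.ofFintype (fun y => ∏ i, p i (y i)) (by
    classical
    rw [← Fintype.piFinset_univ, ← Finset.prod_univ_sum]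
    refine Finset.prod_eq_one fun i _ => ?_
    exact (tsum_fintype fun y => p i y).symm.trans (p i).tsum_coe)

/-- The joint distribution `(a, b) ↦ P a * K a b` of a pair with first marginal `P` and
conditional distribution `K` of the second component given the first. -/
def jointPMF {A : Type u} {B : Type v} (P : PMF A) (K : A → PMF B) : PMF (A × B) :=
  P.bind fun a => (K a).map (Prod.mk a)

/-- Relative entropy `D(P‖Q) = ∑ x, P x log (P x / Q x)` (natural logarithm), with
`0 log (0 / q) = 0` and `p log (p / 0) = ∞` for `p > 0`. -/
def relEntropy {A : Type w} [Fintype A] (P Q : PMF A) : EReal :=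
  ∑ x, (P x : EReal) * ENNReal.log (P x / Q x)

/-- Rényi divergence of order `1 + s`:
`D_{1+s}(P‖Q) = (1 / s) log ∑ x, P x ^ (1 + s) * Q x ^ (-s)` for `s ≠ 0`, computed in `[0, ∞]`
(with `0 * ∞ = 0`, `log 0 = -∞`, `log ∞ = ∞` and `t ^ 0 = 1` for every `t`), and the relative
entropy for `s = 0`. -/
def renyiDiv (s : ℝ) {A : Type w} [Fintype A] (P Q : PMF A) : EReal :=
  if s = 0 then relEntropy P Q
  else ((s⁻¹ : ℝ) : EReal) * ENNReal.log (∑ x, P x ^ (1 + s) * Q x ^ (-s))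

open Classical in
/-- The order-zero divergence under the other common convention, in which the sum runs over the
support of `P` only (`0 ^ 0 = 0`): `-log Q {x | P x > 0}`. -/
def suppDivZero {A : Type w} [Fintype A] (P Q : PMF A) : EReal :=
  -ENNReal.log (∑ x with P x ≠ 0, Q x)

/-- The conditional divergence `∑ x, P x * D_{1+s}(W x ‖ Q)`; at `s = 0` this is
`D(W ‖ Q | P)`. -/
def condRenyiDiv (s : ℝ) {X : Type u} {Y : Type v} [Fintype X] [Fintype Y]
    (W : X → PMF Y) (Q : PMF Y) (P : PMF X) : EReal :=
  ∑ x, (P x : EReal) * renyiDiv s (W x) Q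

/-- The mutual information `I(X;Y) = D(P_{XY} ‖ P_X × P_Y)` for `X ∼ P` and channel `W`. -/
def mutualInformation {X : Type u} {Y : Type v} [Fintype X] [Fintype Y]
    (W : X → PMF Y) (P : PMF X) : EReal :=
  relEntropy (jointPMF P W) (jointPMF P fun _ => P.bind W)

/-- The set of input distributions inducing the output distribution `Q` through `W`. -/
def inputDists {X : Type u} {Y : Type v} (W : X → PMF Y) (Q : PMF Y) : Set (PMF X) :=
  {P | P.bind W = Q}

/-- Number of messages `e ^ (n R)`, rounded up to an integer. -/
def numMessages (n : ℕ) (R : ℝ) : ℕ := ⌈Real.exp (n * R)⌉₊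

instance (n : ℕ) (R : ℝ) : NeZero (numMessages n R) :=
  ⟨(Nat.ceil_pos.2 (Real.exp_pos _)).ne'⟩

/-- The output distribution of the memoryless channel `W` when a uniformly distributed message is
encoded by the codebook `f`: `y ↦ (1 / M) ∑ m, ∏ i, W (f m i) (y i)`. -/
def codeOutput {X : Type u} {Y : Type v} [Fintype Y] (W : X → PMF Y) {n M : ℕ} [NeZero M]
    (f : Fin M → Fin n → X) : PMF (Fin n → Y) :=
  (PMF.uniformOfFintype (Fin M)).bind fun m => productPMF fun i => W (f m i)

/-- The smallest discrepancy `inf D(P_{U Y^n} ‖ P_U × Q^n)`, as measured by `D`, over all random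
mappings `f_U`: the common randomness `U` takes values in a finite set, has an arbitrary
distribution, and is independent of the message. -/
def optimalDiscrepancy (D : ∀ (A : Type v) [Fintype A], PMF A → PMF A → EReal)
    {X : Type u} {Y : Type v} [Fintype Y] (W : X → PMF Y) (Q : PMF Y)
    (n M : ℕ) [NeZero M] : EReal :=
  ⨅ (k : ℕ) (PU : PMF (Fin k)) (f : Fin k → Fin M → Fin n → X),
    D (Fin k × (Fin n → Y)) (jointPMF PU fun u => codeOutput W (f u))
      (jointPMF PU fun _ => productPMF fun _ => Q)

/-- The rates `R > 0` at which the normalized optimal discrepancy vanishes. -/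
def vanishingRates (D : ∀ (A : Type v) [Fintype A], PMF A → PMF A → EReal)
    {X : Type u} {Y : Type v} [Fintype Y] (W : X → PMF Y) (Q : PMF Y) : Set ℝ :=
  {R | 0 < R ∧ Tendsto
    (fun n : ℕ => (((n : ℝ)⁻¹ : ℝ) : EReal) * optimalDiscrepancy D W Q n (numMessages n R))
    atTop (𝓝 0)}

/-- The rates at which the normalized Rényi resolvability of order `1 + s` vanishes. -/
def renyiRates (s : ℝ) {X : Type u} {Y : Type v} [Fintype Y] (W : X → PMF Y) (Q : PMF Y) :
    Set ℝ :=
  vanishingRates (fun _ _ P P' => renyiDiv s P P') W Q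

end

noncomputable section

universe u v w

/-! ### Product, joint and output distributions -/

/-! Everything runs on the sum inside the logarithm, `renyiSum`, which factors over product
distributions and averages over the common randomness.

Achievability. For `0 < s ≤ 1`, the mean over `M` independent codewords of the `(1+s)`-th power of
the output likelihood is at most `M^(-s)` times the single-codeword moment plus the `(1+s)`-th power
of the mean output (`sum_prod_mul_mean_rpow_le`). Codewords drawn from `P^n` itself would make the
first term an average of exponentials. Conditioning `P^n` on codewords whose total divergence is
below `nR` caps that term by `e^{snR} ≤ M^s`, while the mean output grows by a factor of at most 2.
The divergence then stays bounded as soon as `R` exceeds the averaged divergence. Orders `s ≤ 0`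
follow by monotonicity in `s` and the limit `s → 0+`.

Converse. By compactness (`exists_min_linear`), a codeword whose expected output type is close to
`Q` has total divergence at least `n(r - δ)`. Any other codeword sends most of its mass into an
atypical set that is exponentially rare under `Q^n` (`exists_atypical`). For `-1 < s < 0` and `R <
r`, the atypical set together with the regions of high likelihood ratio of the codewords nearly
separates the output from `Q^n`. Hölder's inequality on this set and on its complement makes
`renyiSum` exponentially small, so the divergence grows linearly. Order one reduces to `s = -1/2`.
For `s > 0`, a small divergence keeps the output off the atypical set, so at least half of the
codewords are close to `Q`. Superadditivity of `t ↦ t^(1+s)` adds up their individual sums, which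
forces `M^s` to be about `e^{snr}`.

Order zero. Under `0^0 = 1` the divergence vanishes identically. Under the support convention, a
letter reaching all of the support of `Q` makes a constant code perfect; without one, each codeword
covers an exponentially small part of `Q^n`, and a union bound over the messages excludes small
rates. -/

theorem productPMF_apply {Y : Type v} [Fintype Y] {n : ℕ} (p : Fin n → PMF Y) (y : Fin n → Y) :
    productPMF p y = ∏ i, p i (y i) := rfl

theorem jointPMF_apply {A : Type u} {B : Type v} [Fintype A] (P : PMF A) (K : A → PMF B)
    (a : A) (b : B) : jointPMF P K (a, b) = P a * K a b := by
  classical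
  rw [jointPMF, PMF.bind_apply, tsum_fintype, Finset.sum_eq_single a]
  · rw [PMF.map_apply, tsum_eq_single b]
    · simp
    · intro b' hb'
      simp [hb'.symm]
  · intro a' _ ha'
    rw [PMF.map_apply]
    simp [ha'.symm]
  · simp

theorem PMF.sum_coe {A : Type u} [Fintype A] (P : PMF A) : ∑ a, P a = 1 := by
  rw [← tsum_fintype (L := SummationFilter.unconditional A), P.tsum_coe]

theorem PMF.sum_toReal {A : Type u} [Fintype A] (P : PMF A) : ∑ a, (P a).toReal = 1 := by
  rw [← ENNReal.toReal_sum fun a _ => P.apply_ne_top a, P.sum_coe, ENNReal.toReal_one]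

theorem PMF.bind_apply_fintype {A : Type u} {B : Type v} [Fintype A] (P : PMF A) (K : A → PMF B)
    (b : B) : P.bind K b = ∑ a, P a * K a b := by
  rw [PMF.bind_apply, tsum_fintype]

theorem codeOutput_apply {X : Type u} {Y : Type v} [Fintype Y] (W : X → PMF Y) {n M : ℕ} [NeZero M]
    (f : Fin M → Fin n → X) (y : Fin n → Y) :
    codeOutput W f y = ∑ m, (M : ℝ≥0∞)⁻¹ * productPMF (fun i => W (f m i)) y := by
  rw [codeOutput, PMF.bind_apply_fintype]
  simp

/-! ### Rényi divergences -/

section Divergence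

variable {A : Type w} [Fintype A]

/-- The sum `∑ x, P x ^ (1 + s) * Q x ^ (-s)` inside the logarithm of the Rényi divergence. -/
def renyiSum (s : ℝ) (P Q : PMF A) : ℝ≥0∞ := ∑ x, P x ^ (1 + s) * Q x ^ (-s)

theorem renyiDiv_of_ne_zero {s : ℝ} (hs : s ≠ 0) (P Q : PMF A) :
    renyiDiv s P Q = ((s⁻¹ : ℝ) : EReal) * ENNReal.log (renyiSum s P Q) := if_neg hs

theorem renyiDiv_zero (P Q : PMF A) : renyiDiv 0 P Q = relEntropy P Q := if_pos rfl

/-- The moment generating function of the information density at `s`. -/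
def densityMGF (P Q : PMF A) (s : ℝ) : ℝ :=
  ∑ x, (P x).toReal * Real.exp (s * Real.log ((P x).toReal / (Q x).toReal))

/-- The condition `-1 < s` makes `0 ^ (1 + s) = 0`, matching the zero weight in `densityMGF`;
absolute continuity keeps the logarithm away from its default value at a zero denominator. -/
theorem densityMGF_eq_sum_rpow {s : ℝ} (hs : -1 < s) {P Q : PMF A} (h : ∀ x, Q x = 0 → P x = 0) :
    densityMGF P Q s = ∑ x, (P x).toReal ^ (1 + s) * (Q x).toReal ^ (-s) := by
  refine Finset.sum_congr rfl fun x _ => ?_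
  by_cases hP : P x = 0
  · simp [hP, Real.zero_rpow (show 1 + s ≠ 0 by linarith)]
  have hQ : Q x ≠ 0 := fun h0 => hP (h x h0)
  have hp : 0 < (P x).toReal := ENNReal.toReal_pos hP (P.apply_ne_top x)
  have hq : 0 < (Q x).toReal := ENNReal.toReal_pos hQ (Q.apply_ne_top x)
  rw [Real.log_div hp.ne' hq.ne', Real.rpow_def_of_pos hp, Real.rpow_def_of_pos hq]
  conv_lhs => rw [← Real.exp_log hp]
  rw [Real.log_exp, ← Real.exp_add, ← Real.exp_add]
  ring_nf

theorem renyiSum_eq_ofReal {s : ℝ} (hs : -1 < s) {P Q : PMF A} (h : ∀ x, Q x = 0 → P x = 0) :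
    renyiSum s P Q = ENNReal.ofReal (densityMGF P Q s) := by
  rw [renyiSum, densityMGF_eq_sum_rpow hs h, ENNReal.ofReal_sum_of_nonneg fun x _ => by positivity]
  refine Finset.sum_congr rfl fun x _ => ?_
  by_cases hP : P x = 0
  · simp [hP, ENNReal.zero_rpow_of_pos (show 0 < 1 + s by linarith),
      Real.zero_rpow (show 1 + s ≠ 0 by linarith)]
  have hQ : Q x ≠ 0 := fun h0 => hP (h x h0)
  have hp : 0 < (P x).toReal := ENNReal.toReal_pos hP (P.apply_ne_top x)
  have hq : 0 < (Q x).toReal := ENNReal.toReal_pos hQ (Q.apply_ne_top x)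
  rw [ENNReal.ofReal_mul (by positivity), ← ENNReal.ofReal_rpow_of_pos hp,
    ← ENNReal.ofReal_rpow_of_pos hq, ENNReal.ofReal_toReal (P.apply_ne_top x),
    ENNReal.ofReal_toReal (Q.apply_ne_top x)]

/-- The mean of the information density, a real version of the relative entropy. -/
def densityMean (P Q : PMF A) : ℝ :=
  ∑ x, (P x).toReal * Real.log ((P x).toReal / (Q x).toReal)

omit [Fintype A] in
theorem exists_pmf_ne_zero (P : PMF A) : ∃ x, P x ≠ 0 := by
  obtain ⟨x, hx⟩ := P.support_nonempty
  exact ⟨x, (P.mem_support_iff x).1 hx⟩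

theorem densityMGF_pos (P Q : PMF A) (s : ℝ) : 0 < densityMGF P Q s := by
  obtain ⟨x, hx⟩ := exists_pmf_ne_zero P
  refine Finset.sum_pos' (fun x _ => by positivity) ⟨x, Finset.mem_univ x, ?_⟩
  have := ENNReal.toReal_pos hx (P.apply_ne_top x)
  positivity

theorem renyiDiv_eq_coe {s : ℝ} (hs : -1 < s) (hs0 : s ≠ 0) {P Q : PMF A}
    (h : ∀ x, Q x = 0 → P x = 0) :
    renyiDiv s P Q = ((s⁻¹ * Real.log (densityMGF P Q s) : ℝ) : EReal) := by
  rw [renyiDiv_of_ne_zero hs0, renyiSum_eq_ofReal hs h, ENNReal.log_ofReal_of_pos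
    (densityMGF_pos P Q s), ← EReal.coe_mul]

theorem EReal.coe_finset_sum {ι : Type*} (t : Finset ι) (f : ι → ℝ) :
    ((∑ i ∈ t, f i : ℝ) : EReal) = ∑ i ∈ t, (f i : EReal) := by
  classical
  induction t using Finset.induction_on with
  | empty => simp
  | insert i t hi ih => rw [Finset.sum_insert hi, Finset.sum_insert hi, EReal.coe_add, ih]

omit [Fintype A] in
theorem PMF.coe_ereal_apply (P : PMF A) (x : A) : (P x : EReal) = ((P x).toReal : EReal) := by
  rw [← EReal.toReal_coe_ennreal, EReal.coe_toReal (by simp [P.apply_ne_top]) (by simp)]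

theorem relEntropy_eq_coe {P Q : PMF A} (h : ∀ x, Q x = 0 → P x = 0) :
    relEntropy P Q = (densityMean P Q : EReal) := by
  rw [relEntropy, densityMean, EReal.coe_finset_sum]
  refine Finset.sum_congr rfl fun x _ => ?_
  by_cases hP : P x = 0
  · simp [hP]
  have hQ : Q x ≠ 0 := fun h0 => hP (h x h0)
  rw [ENNReal.log_pos_real (ENNReal.div_ne_zero.2 ⟨hP, Q.apply_ne_top x⟩)
    (ENNReal.div_ne_top (P.apply_ne_top x) hQ), ENNReal.toReal_div, PMF.coe_ereal_apply,
    EReal.coe_mul]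

theorem EReal.sum_eq_top {ι : Type*} {t : Finset ι} {f : ι → EReal} (hb : ∀ i ∈ t, f i ≠ ⊥)
    {i : ι} (hi : i ∈ t) (h : f i = ⊤) : ∑ i ∈ t, f i = ⊤ := by
  classical
  rw [← Finset.add_sum_erase t f hi, h]
  refine EReal.top_add_of_ne_bot ?_
  have : ∀ r : Finset ι, (∀ i ∈ r, f i ≠ ⊥) → ∑ i ∈ r, f i ≠ ⊥ := by
    intro r
    induction r using Finset.induction_on with
    | empty => simp
    | insert i r hi ih =>
      intro h
      rw [Finset.sum_insert hi]
      refine EReal.add_ne_bot_iff.2 ⟨h i (by simp), ih fun j hj => h j (by simp [hj])⟩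
  exact this _ fun j hj => hb j (Finset.mem_of_mem_erase hj)

theorem relEntropy_eq_top {P Q : PMF A} (h : ¬ ∀ x, Q x = 0 → P x = 0) : relEntropy P Q = ⊤ := by
  push Not at h
  obtain ⟨x, hQ, hP⟩ := h
  refine EReal.sum_eq_top (fun z _ => ?_) (Finset.mem_univ x) ?_
  · by_cases hz : P z = 0
    · simp [hz]
    have hlog : ENNReal.log (P z / Q z) ≠ ⊥ := by
      rw [Ne, ENNReal.log_eq_bot_iff, ENNReal.div_eq_zero_iff]
      simp [hz, Q.apply_ne_top]
    have hpos : 0 < (P z).toReal := ENNReal.toReal_pos hz (P.apply_ne_top z)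
    rw [PMF.coe_ereal_apply]
    induction hl : ENNReal.log (P z / Q z) with
    | bot => exact absurd hl hlog
    | coe r => rw [← EReal.coe_mul]; exact EReal.coe_ne_bot _
    | top => rw [EReal.coe_mul_top_of_pos hpos]; simp
  · have hpos : 0 < (P x).toReal := ENNReal.toReal_pos hP (P.apply_ne_top x)
    rw [hQ, ENNReal.div_zero hP, ENNReal.log_top, PMF.coe_ereal_apply,
      EReal.coe_mul_top_of_pos hpos]

theorem renyiSum_eq_top {s : ℝ} (hs : 0 < s) {P Q : PMF A} (h : ¬ ∀ x, Q x = 0 → P x = 0) :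
    renyiSum s P Q = ⊤ := by
  push Not at h
  obtain ⟨x, hQ, hP⟩ := h
  refine ENNReal.sum_eq_top.2 ⟨x, Finset.mem_univ x, ?_⟩
  rw [hQ, ENNReal.zero_rpow_of_neg (by linarith), ENNReal.mul_top]
  exact (ENNReal.rpow_pos (pos_iff_ne_zero.2 hP) (P.apply_ne_top x)).ne'

theorem renyiDiv_eq_top {s : ℝ} (hs : 0 < s) {P Q : PMF A} (h : ¬ ∀ x, Q x = 0 → P x = 0) :
    renyiDiv s P Q = ⊤ := by
  rw [renyiDiv_of_ne_zero hs.ne', renyiSum_eq_top hs h, ENNReal.log_top,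
    EReal.coe_mul_top_of_pos (inv_pos.2 hs)]

/-- Jensen's inequality for the information density. -/
theorem mul_densityMean_le (P Q : PMF A) (s : ℝ) :
    s * densityMean P Q ≤ Real.log (densityMGF P Q s) := by
  rw [Real.le_log_iff_exp_le (densityMGF_pos P Q s)]
  have := convexOn_exp.map_sum_le (t := Finset.univ) (w := fun x => (P x).toReal)
    (p := fun x => s * Real.log ((P x).toReal / (Q x).toReal))
    (fun x _ => ENNReal.toReal_nonneg) P.sum_toReal (fun x _ => Set.mem_univ _)
  simp only [smul_eq_mul] at this
  refine le_trans (le_of_eq ?_) this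
  rw [densityMean, Finset.mul_sum]
  congr 1
  exact Finset.sum_congr rfl fun x _ => by ring

theorem renyiDiv_zero_le {s : ℝ} (hs : 0 < s) (P Q : PMF A) :
    renyiDiv 0 P Q ≤ renyiDiv s P Q := by
  by_cases h : ∀ x, Q x = 0 → P x = 0
  · rw [renyiDiv_zero, relEntropy_eq_coe h, renyiDiv_eq_coe (by linarith) hs.ne' h,
      EReal.coe_le_coe_iff, ← div_eq_inv_mul, le_div_iff₀ hs, mul_comm]
    exact mul_densityMean_le P Q s
  · rw [renyiDiv_eq_top hs h]
    exact le_top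

theorem renyiDiv_le_zero {s : ℝ} (hs : -1 < s) (hs0 : s < 0) (P Q : PMF A) :
    renyiDiv s P Q ≤ renyiDiv 0 P Q := by
  by_cases h : ∀ x, Q x = 0 → P x = 0
  · rw [renyiDiv_zero, relEntropy_eq_coe h, renyiDiv_eq_coe hs hs0.ne h,
      EReal.coe_le_coe_iff, ← div_eq_inv_mul, div_le_iff_of_neg hs0, mul_comm]
    exact mul_densityMean_le P Q s
  · rw [renyiDiv_zero, relEntropy_eq_top h]
    exact le_top

omit [Fintype A] in
-- Hölder with conjugate exponents `1/(1+s)` and `1/(-s)`. An arbitrary `G` is allowed because the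
-- converse applies it separately to a set rare under `Q` and to a set rare under `P`.
theorem sum_rpow_mul_rpow_le {s : ℝ} (hs : -1 < s) (hs0 : s < 0) (P Q : PMF A) (G : Finset A) :
    ∑ x ∈ G, P x ^ (1 + s) * Q x ^ (-s) ≤ (∑ x ∈ G, P x) ^ (1 + s) * (∑ x ∈ G, Q x) ^ (-s) := by
  have hpq : (1 + s)⁻¹.HolderConjugate (-s)⁻¹ := by
    refine Real.holderConjugate_iff.2 ⟨(one_lt_inv₀ (by linarith)).2 (by linarith), ?_⟩
    simp
  have := ENNReal.inner_le_Lp_mul_Lq G (fun x => P x ^ (1 + s)) (fun x => Q x ^ (-s)) hpq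
  have h1 : (1 + s) ≠ 0 := by linarith
  have h2 : -s ≠ 0 := by linarith
  simpa only [← ENNReal.rpow_mul, mul_inv_cancel₀ h1, mul_inv_cancel₀ h2, ENNReal.rpow_one,
    one_div, inv_inv] using this

/-- For negative `s`, Hölder on the whole space gives a sum of at most 1; the other orders follow by
monotonicity through `s = -1/2`. -/
theorem renyiDiv_nonneg {s : ℝ} (hs : -1 < s) (P Q : PMF A) : 0 ≤ renyiDiv s P Q := by
  have neg : ∀ s : ℝ, -1 < s → s < 0 → 0 ≤ renyiDiv s P Q := by
    intro s hs hs0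
    have h1 : renyiSum s P Q ≤ 1 := by
      have := sum_rpow_mul_rpow_le hs hs0 P Q Finset.univ
      rwa [P.sum_coe, Q.sum_coe, ENNReal.one_rpow, ENNReal.one_rpow, mul_one] at this
    rw [renyiDiv_of_ne_zero hs0.ne]
    exact EReal.mul_nonneg_iff.2 (Or.inr ⟨by exact_mod_cast (inv_lt_zero.2 hs0).le,
      ENNReal.log_le_zero_iff.2 h1⟩)
  have h0 : 0 ≤ renyiDiv 0 P Q :=
    (neg (-1 / 2) (by norm_num) (by norm_num)).trans
      (renyiDiv_le_zero (by norm_num) (by norm_num) P Q)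
  rcases lt_trichotomy s 0 with h | rfl | h
  · exact neg s hs h
  · exact h0
  · exact h0.trans (renyiDiv_zero_le h P Q)

/-- The powers `1 + s` and `-s` of the common marginal multiply to its first power, so common
randomness only averages the sums of the individual codes. -/
theorem renyiSum_jointPMF {B : Type v} [Fintype B] {s : ℝ} (hs : -1 < s) (P : PMF A)
    (K L : A → PMF B) :
    renyiSum s (jointPMF P K) (jointPMF P L) = ∑ a, P a * renyiSum s (K a) (L a) := by
  rw [renyiSum, Fintype.sum_prod_type]
  refine Finset.sum_congr rfl fun a _ => ?_
  rw [renyiSum, Finset.mul_sum]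
  refine Finset.sum_congr rfl fun b _ => ?_
  rw [jointPMF_apply, jointPMF_apply]
  by_cases ha : P a = 0
  · simp [ha, ENNReal.zero_rpow_of_pos (show 0 < 1 + s by linarith)]
  have e : P a ^ (1 + s) * P a ^ (-s) = P a := by
    rw [← ENNReal.rpow_add _ _ ha (P.apply_ne_top a)]
    simp
  rw [ENNReal.mul_rpow_of_nonneg _ _ (by linarith : 0 ≤ 1 + s),
    ENNReal.mul_rpow_of_ne_top (P.apply_ne_top a) ((L a).apply_ne_top b), mul_mul_mul_comm, e]

end Divergence

/-! ### Concentration for product distributions -/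

theorem Fintype.sum_prod_fin {Y : Type v} [Fintype Y] {n : ℕ} {R : Type*} [CommSemiring R]
    (f : Fin n → Y → R) : ∑ y : Fin n → Y, ∏ i, f i (y i) = ∏ i, ∑ y, f i y := by
  classical
  rw [Finset.prod_univ_sum, Fintype.piFinset_univ]

theorem exp_le_one_add_add_sq {t : ℝ} (ht : |t| ≤ 1) : Real.exp t ≤ 1 + t + t ^ 2 := by
  have := Real.abs_exp_sub_one_sub_id_le ht
  linarith [le_abs_self (Real.exp t - 1 - t)]

theorem sum_mul_exp_le {Y : Type v} [Fintype Y] {p g : Y → ℝ} {B l : ℝ} (hp : ∀ y, 0 ≤ p y)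
    (hp1 : ∑ y, p y = 1) (hg : ∀ y, |g y| ≤ B) (hmean : ∑ y, p y * g y = 0) (hl : 0 ≤ l)
    (hlB : l * B ≤ 1) : ∑ y, p y * Real.exp (l * g y) ≤ Real.exp (l ^ 2 * B ^ 2) := by
  have h1 : ∀ y, p y * Real.exp (l * g y) ≤ p y + l * (p y * g y) + l ^ 2 * B ^ 2 * p y := by
    intro y
    have h2 : |l * g y| ≤ 1 := by
      rw [abs_mul, abs_of_nonneg hl]
      exact (mul_le_mul_of_nonneg_left (hg y) hl).trans hlB
    have h3 : (l * g y) ^ 2 ≤ l ^ 2 * B ^ 2 := by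
      rw [mul_pow]
      exact mul_le_mul_of_nonneg_left (sq_le_sq.2 ((hg y).trans (le_abs_self B))) (sq_nonneg l)
    nlinarith [exp_le_one_add_add_sq h2, hp y]
  calc ∑ y, p y * Real.exp (l * g y)
      ≤ ∑ y, (p y + l * (p y * g y) + l ^ 2 * B ^ 2 * p y) := Finset.sum_le_sum fun y _ => h1 y
    _ = l ^ 2 * B ^ 2 + 1 := by
      rw [Finset.sum_add_distrib, Finset.sum_add_distrib, ← Finset.mul_sum, ← Finset.mul_sum,
        hmean, hp1]
      ring
    _ ≤ _ := Real.add_one_le_exp _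

/-- The exponent `c` depends only on `B` and `δ`. This uniformity over `n` and over non-identical
factors is needed because the output letters given a codeword are independent but differently
distributed. -/
theorem chernoff_centered {B δ : ℝ} (hB : 0 < B) (hδ : 0 < δ) : ∃ c > 0, ∀ {Y : Type v} [Fintype Y]
    {n : ℕ} (p g : Fin n → Y → ℝ), (∀ i y, 0 ≤ p i y) → (∀ i, ∑ y, p i y = 1) →
    (∀ i y, |g i y| ≤ B) → (∀ i, ∑ y, p i y * g i y = 0) →
    ∑ y : Fin n → Y with n * δ ≤ ∑ i, g i (y i), ∏ i, p i (y i) ≤ Real.exp (-(n * c)) := by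
  -- The bound `1 / B` keeps the exponents in the range of the quadratic estimate. The bound `δ / (2
  -- * B ^ 2)` makes the cost `l² B²` per letter at most half of the gain `l δ`.
  set l := min (1 / B) (δ / (2 * B ^ 2)) with hl
  have hl0 : 0 < l := by positivity
  have hl1 : l * B ≤ 1 := by
    rw [← le_div_iff₀ hB]
    exact min_le_left _ _
  have hl2 : l * B ^ 2 ≤ δ / 2 := by
    have : l ≤ δ / (2 * B ^ 2) := min_le_right _ _
    rw [le_div_iff₀ (by positivity)] at this
    linarith
  refine ⟨l * δ / 2, by positivity, ?_⟩
  intro Y _ n p g hp hp1 hg hmean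
  have h0 : ∀ y : Fin n → Y, 0 ≤ ∏ i, p i (y i) := fun y => Finset.prod_nonneg fun i _ => hp i _
  calc ∑ y : Fin n → Y with n * δ ≤ ∑ i, g i (y i), ∏ i, p i (y i)
      ≤ ∑ y : Fin n → Y with n * δ ≤ ∑ i, g i (y i),
          Real.exp (-(l * (n * δ))) * ∏ i, (p i (y i) * Real.exp (l * g i (y i))) := by
        refine Finset.sum_le_sum fun y hy => ?_
        rw [Finset.mem_filter] at hy
        rw [Finset.prod_mul_distrib, ← Real.exp_sum, ← Finset.mul_sum, mul_left_comm,
          ← Real.exp_add]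
        refine le_mul_of_one_le_right (h0 y) (Real.one_le_exp ?_)
        nlinarith [hy.2]
    _ ≤ ∑ y : Fin n → Y,
          Real.exp (-(l * (n * δ))) * ∏ i, (p i (y i) * Real.exp (l * g i (y i))) :=
        Finset.sum_le_sum_of_subset_of_nonneg (Finset.filter_subset _ _) fun y _ _ =>
          mul_nonneg (Real.exp_nonneg _)
            (Finset.prod_nonneg fun i _ => mul_nonneg (hp i _) (Real.exp_nonneg _))
    _ = Real.exp (-(l * (n * δ))) * ∏ i, ∑ y, p i y * Real.exp (l * g i y) := by
        rw [← Finset.mul_sum, Fintype.sum_prod_fin fun i y => p i y * Real.exp (l * g i y)]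
    _ ≤ Real.exp (-(l * (n * δ))) * ∏ _i : Fin n, Real.exp (l ^ 2 * B ^ 2) := by
        refine mul_le_mul_of_nonneg_left (Finset.prod_le_prod (fun i _ => Finset.sum_nonneg
          fun y _ => mul_nonneg (hp i _) (Real.exp_nonneg _)) fun i _ => ?_) (Real.exp_nonneg _)
        exact sum_mul_exp_le (hp i) (hp1 i) (hg i) (hmean i) hl0.le hl1
    _ ≤ Real.exp (-(n * (l * δ / 2))) := by
        rw [← Real.exp_sum, ← Real.exp_add, Real.exp_le_exp, Finset.sum_const, Finset.card_univ,
          Fintype.card_fin, nsmul_eq_mul]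
        have : l * (l * B ^ 2) ≤ l * (δ / 2) := mul_le_mul_of_nonneg_left hl2 hl0.le
        have hn : (0 : ℝ) ≤ n := n.cast_nonneg
        nlinarith [mul_le_mul_of_nonneg_left this hn]

/-- Exponential concentration of sums of independent bounded variables above their mean. -/
theorem chernoff {Y : Type v} [Fintype Y] {B δ : ℝ} (hB : 0 ≤ B) (hδ : 0 < δ) :
    ∃ c > 0, ∀ {n : ℕ} (p : Fin n → PMF Y) (g : Fin n → Y → ℝ), (∀ i y, |g i y| ≤ B) →
    ∑ y : Fin n → Y with ∑ i, ∑ b, (p i b).toReal * g i b + n * δ ≤ ∑ i, g i (y i),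
      productPMF p y ≤ ENNReal.ofReal (Real.exp (-(n * c))) := by
  -- Centering doubles the bound; the extra 1 keeps it positive when `B = 0`.
  obtain ⟨c, hc, h⟩ := chernoff_centered.{v} (B := 2 * B + 1) (by linarith) hδ
  refine ⟨c, hc, fun {n} p g hg => ?_⟩
  have hmean : ∀ i, |∑ b, (p i b).toReal * g i b| ≤ B := fun i => by
    calc |∑ b, (p i b).toReal * g i b| ≤ ∑ b, |(p i b).toReal * g i b| :=
          Finset.abs_sum_le_sum_abs _ _
      _ ≤ ∑ b, (p i b).toReal * B := Finset.sum_le_sum fun b _ => by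
          rw [abs_mul, abs_of_nonneg ENNReal.toReal_nonneg]
          exact mul_le_mul_of_nonneg_left (hg i b) ENNReal.toReal_nonneg
      _ = B := by rw [← Finset.sum_mul, PMF.sum_toReal, one_mul]
  have := h (fun i y => (p i y).toReal) (fun i y => g i y - ∑ b, (p i b).toReal * g i b)
    (fun i y => ENNReal.toReal_nonneg) (fun i => PMF.sum_toReal _)
    (fun i y => by
      have := abs_sub (g i y) (∑ b, (p i b).toReal * g i b)
      linarith [hg i y, hmean i])
    (fun i => by
      simp only [mul_sub, Finset.sum_sub_distrib]
      rw [← Finset.sum_mul, PMF.sum_toReal, one_mul, sub_self])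
  rw [ENNReal.le_ofReal_iff_toReal_le
    (ENNReal.sum_ne_top.2 fun y _ => PMF.apply_ne_top _ _) (Real.exp_nonneg _),
    ENNReal.toReal_sum fun y _ => PMF.apply_ne_top _ _]
  refine le_trans (le_of_eq ?_) this
  refine Finset.sum_congr ?_ fun y _ => ?_
  · ext y
    simp only [Finset.mem_filter, Finset.mem_univ, true_and, Finset.sum_sub_distrib]
    constructor <;> intro h <;> linarith
  · rw [productPMF_apply, ENNReal.toReal_prod]

/-! ### Input distributions and types of codewords -/

section Inputs

variable {X : Type u} {Y : Type v} [Fintype X]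

theorem exists_pmf_toReal_eq {t : X → ℝ} (ht : t ∈ stdSimplex ℝ X) :
    ∃ P : PMF X, ∀ x, (P x).toReal = t x := by
  refine ⟨PMF.ofFintype (fun x => ENNReal.ofReal (t x)) ?_, fun x => ?_⟩
  · rw [← ENNReal.ofReal_sum_of_nonneg fun x _ => ht.1 x, ht.2, ENNReal.ofReal_one]
  · rw [PMF.ofFintype_apply, ENNReal.toReal_ofReal (ht.1 x)]

theorem PMF.toReal_mem_stdSimplex (P : PMF X) : (fun x => (P x).toReal) ∈ stdSimplex ℝ X :=
  ⟨fun _ => ENNReal.toReal_nonneg, P.sum_toReal⟩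

theorem mem_inputDists_iff {W : X → PMF Y} {Q : PMF Y} {P : PMF X} :
    P ∈ inputDists W Q ↔ ∀ y, ∑ x, (P x).toReal * (W x y).toReal = (Q y).toReal := by
  have h : ∀ y, ∑ x, (P x).toReal * (W x y).toReal = (P.bind W y).toReal := fun y => by
    rw [PMF.bind_apply_fintype, ENNReal.toReal_sum fun x _ =>
      ENNReal.mul_ne_top (P.apply_ne_top x) ((W x).apply_ne_top y)]
    simp
  simp only [h, inputDists, Set.mem_ofPred_eq]
  refine ⟨fun h y => by rw [h], fun h => PMF.ext fun y => ?_⟩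
  exact (ENNReal.toReal_eq_toReal_iff' ((P.bind W).apply_ne_top y) (Q.apply_ne_top y)).1 (h y)

theorem channel_eq_zero {W : X → PMF Y} {Q : PMF Y} {P : PMF X} (hP : P ∈ inputDists W Q)
    {x : X} (hx : P x ≠ 0) {y : Y} (hy : Q y = 0) : W x y = 0 := by
  have h : P.bind W y = 0 := by rw [show P.bind W = Q from hP, hy]
  rw [PMF.bind_apply_fintype, Finset.sum_eq_zero_iff] at h
  exact (mul_eq_zero.1 (h x (Finset.mem_univ x))).resolve_left hx

variable [Fintype Y]

/-- Minimization of a linear functional over the input distributions inducing `Q`, with a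
lower semicontinuity statement for the input distributions that approximately induce `Q`. -/
theorem exists_min_linear (W : X → PMF Y) (Q : PMF Y) (hne : (inputDists W Q).Nonempty)
    (d : X → ℝ) : ∃ r : ℝ, (∃ P ∈ inputDists W Q, ∑ x, (P x).toReal * d x = r) ∧
      (∀ P ∈ inputDists W Q, r ≤ ∑ x, (P x).toReal * d x) ∧
      ∀ δ > 0, ∃ η > 0, ∀ t ∈ stdSimplex ℝ X,
        (∀ y, |∑ x, t x * (W x y).toReal - (Q y).toReal| < η) → r - δ ≤ ∑ x, t x * d x := by
  set φ : (X → ℝ) → ℝ := fun t => ∑ x, t x * d x with hφ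
  -- The `ℓ¹` defect of the induced output; its zeros on the simplex are exactly the distributions
  -- in `inputDists W Q`.
  set ψ : (X → ℝ) → ℝ := fun t => ∑ y, |∑ x, t x * (W x y).toReal - (Q y).toReal| with hψ
  have hφc : Continuous φ := by fun_prop
  have hψc : Continuous ψ := by fun_prop
  have hψ0 : ∀ t, 0 ≤ ψ t := fun t => Finset.sum_nonneg fun y _ => abs_nonneg _
  have hψz : ∀ P : PMF X, ψ (fun x => (P x).toReal) = 0 ↔ P ∈ inputDists W Q := fun P => by
    rw [hψ, mem_inputDists_iff, Finset.sum_eq_zero_iff_of_nonneg fun y _ => abs_nonneg _]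
    simp [sub_eq_zero]
  have hK : IsCompact (stdSimplex ℝ X ∩ ψ ⁻¹' {0}) :=
    (isCompact_stdSimplex ℝ X).inter_right (isClosed_singleton.preimage hψc)
  obtain ⟨P₀, hP₀⟩ := hne
  obtain ⟨t, ⟨ht, htψ⟩, hmin⟩ := hK.exists_isMinOn
    ⟨_, P₀.toReal_mem_stdSimplex, (hψz P₀).2 hP₀⟩ hφc.continuousOn
  obtain ⟨P, hP⟩ := exists_pmf_toReal_eq ht
  have hPt : (fun x => (P x).toReal) = t := funext hP
  refine ⟨φ t, ⟨P, (hψz P).1 (by rw [hPt]; exact htψ), by rw [← hPt]⟩, fun P' hP' =>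
    hmin ⟨P'.toReal_mem_stdSimplex, (hψz P').2 hP'⟩, fun δ hδ => ?_⟩
  have hC : IsCompact (stdSimplex ℝ X ∩ φ ⁻¹' Set.Iic (φ t - δ)) :=
    (isCompact_stdSimplex ℝ X).inter_right (isClosed_Iic.preimage hφc)
  -- On the compact set where the functional is at most its minimum minus `δ`, the defect attains a
  -- minimum, which cannot be zero by minimality of `φ t`.
  have key : ∃ ε > 0, ∀ t' ∈ stdSimplex ℝ X ∩ φ ⁻¹' Set.Iic (φ t - δ), ε ≤ ψ t' := by
    rcases (stdSimplex ℝ X ∩ φ ⁻¹' Set.Iic (φ t - δ)).eq_empty_or_nonempty with he | he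
    · exact ⟨1, one_pos, by simp [he]⟩
    obtain ⟨t₁, ht₁, hmin₁⟩ := hC.exists_isMinOn he hψc.continuousOn
    refine ⟨ψ t₁, lt_of_le_of_ne (hψ0 t₁) fun h0 => ?_, fun t' ht' => hmin₁ ht'⟩
    have h1 : φ t ≤ φ t₁ := hmin ⟨ht₁.1, h0.symm⟩
    have h2 : φ t₁ ≤ φ t - δ := ht₁.2
    linarith
  obtain ⟨ε, hε, hεψ⟩ := key
  refine ⟨ε / (Fintype.card Y + 1), by positivity, fun t' ht' hclose => ?_⟩
  by_contra hlt
  have h1 := hεψ t' ⟨ht', (not_le.1 hlt).le⟩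
  have h2 : ψ t' ≤ ∑ _y : Y, ε / (Fintype.card Y + 1) :=
    Finset.sum_le_sum fun y _ => (hclose y).le
  rw [Finset.sum_const, Finset.card_univ, nsmul_eq_mul, ← mul_div_assoc] at h2
  have h3 : (Fintype.card Y : ℝ) * ε / (Fintype.card Y + 1) < ε := by
    rw [div_lt_iff₀ (by positivity)]
    nlinarith
  linarith

/-- The witness is the empirical distribution of the sequence. -/
theorem exists_type {n : ℕ} (hn : 0 < n) (x : Fin n → X) :
    ∃ t ∈ stdSimplex ℝ X, ∀ d : X → ℝ, n * ∑ a, t a * d a = ∑ i, d (x i) := by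
  classical
  have hn' : (n : ℝ) ≠ 0 := by positivity
  have h : ∀ d : X → ℝ,
      n * ∑ a, ((∑ i, if x i = a then (1 : ℝ) else 0) / n) * d a = ∑ i, d (x i) := fun d => by
    rw [Finset.mul_sum]
    have : ∀ a, (n : ℝ) * (((∑ i, if x i = a then (1 : ℝ) else 0) / n) * d a)
        = ∑ i, if x i = a then d a else 0 := fun a => by
      rw [← mul_assoc, mul_div_cancel₀ _ hn', Finset.sum_mul]
      simp
    simp only [this]
    rw [Finset.sum_comm]
    simp
  refine ⟨fun a => (∑ i, if x i = a then (1 : ℝ) else 0) / n, ⟨fun a => ?_, ?_⟩, h⟩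
  · exact div_nonneg (Finset.sum_nonneg fun i _ => by split_ifs <;> norm_num) n.cast_nonneg
  · have := h fun _ => 1
    simp only [mul_one, Finset.sum_const, Finset.card_univ, Fintype.card_fin, nsmul_eq_mul] at this
    exact mul_left_cancel₀ hn' (this.trans (mul_one _).symm)

omit [Fintype Y] in
theorem le_sum_of_type_close {W : X → PMF Y} {Q : PMF Y} {d : X → ℝ} {r' η : ℝ}
    (h : ∀ t ∈ stdSimplex ℝ X,
      (∀ y, |∑ x, t x * (W x y).toReal - (Q y).toReal| < η) → r' ≤ ∑ x, t x * d x)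
    {n : ℕ} (hn : 0 < n) (x : Fin n → X)
    (hx : ∀ y, |∑ i, (W (x i) y).toReal - n * (Q y).toReal| < n * η) :
    n * r' ≤ ∑ i, d (x i) := by
  obtain ⟨t, ht, htd⟩ := exists_type hn x
  have hn' : (0 : ℝ) < n := by exact_mod_cast hn
  rw [← htd d]
  refine mul_le_mul_of_nonneg_left (h t ht fun y => ?_) hn'.le
  have := hx y
  rw [← htd fun a => (W a y).toReal, ← mul_sub, abs_mul, abs_of_pos hn'] at this
  exact lt_of_mul_lt_mul_left this hn'.le

/-! ### Atypical outputs -/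

/-- A union bound for a possibly overlapping cover. -/
theorem ENNReal.sum_le_sum_sum {ι κ : Type*} {T : Finset ι} {t : Finset κ} {S : κ → Finset ι}
    (h : ∀ i ∈ T, ∃ k ∈ t, i ∈ S k) (f : ι → ℝ≥0∞) :
    ∑ i ∈ T, f i ≤ ∑ k ∈ t, ∑ i ∈ S k, f i := by
  classical
  rw [Finset.sum_sigma' t S fun _ i => f i]
  rcases T.eq_empty_or_nonempty with rfl | ⟨i₀, hi₀⟩
  · simp
  obtain ⟨k₀, -⟩ := h i₀ hi₀
  have : Nonempty κ := ⟨k₀⟩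
  choose! k hk hS using h
  rw [← Finset.sum_image (f := fun p : (_ : κ) × ι => f p.2) (g := fun i => ⟨k i, i⟩)
    (s := T) fun i _ j _ hij => by simp only [Sigma.mk.injEq] at hij; exact eq_of_heq hij.2]
  refine Finset.sum_le_sum_of_subset fun p hp => ?_
  obtain ⟨i, hi, rfl⟩ := Finset.mem_image.1 hp
  exact Finset.mem_sigma.2 ⟨hk i hi, hS i hi⟩

theorem ENNReal.sum_union_le {ι : Type*} [DecidableEq ι] (S T : Finset ι) (f : ι → ℝ≥0∞) :
    ∑ i ∈ S ∪ T, f i ≤ ∑ i ∈ S, f i + ∑ i ∈ T, f i := by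
  rw [← Finset.sum_union_inter]
  exact le_self_add

theorem chernoff_abs {δ : ℝ} (hδ : 0 < δ) :
    ∃ c > 0, ∀ {n : ℕ} (p : Fin n → PMF Y) (g : Y → ℝ), (∀ y, |g y| ≤ 1) →
    ∑ y : Fin n → Y with n * δ ≤ |∑ i, g (y i) - ∑ i, ∑ b, (p i b).toReal * g b|,
      productPMF p y ≤ 2 * ENNReal.ofReal (Real.exp (-(n * c))) := by
  classical
  obtain ⟨c, hc, h⟩ := chernoff (Y := Y) zero_le_one hδ
  refine ⟨c, hc, fun {n} p g hg => ?_⟩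
  have h1 := h p (fun _ => g) fun _ => hg
  have h2 := h p (fun _ y => -g y) fun _ y => by rw [abs_neg]; exact hg y
  rw [two_mul]
  refine le_trans ?_ (add_le_add h1 h2)
  refine le_trans (Finset.sum_le_sum_of_subset ?_) (ENNReal.sum_union_le _ _ _)
  intro y hy
  simp only [Finset.mem_filter, Finset.mem_univ, true_and, Finset.mem_union,
    Finset.sum_neg_distrib, mul_neg] at hy ⊢
  rcases le_abs'.1 hy with h | h
  · right; linarith
  · left; linarith

omit [Fintype X] in
open Classical in
/-- A set of output sequences that has small probability under `Q ^ n`, but large probability given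
any codeword whose expected output type is far from `Q`. -/
theorem exists_atypical (W : X → PMF Y) (Q : PMF Y) {η : ℝ} (hη : 0 < η) :
    ∃ c > 0, ∃ K : ℝ, 1 ≤ K ∧ ∀ n : ℕ, ∃ S : Finset (Fin n → Y),
      ∑ y ∈ S, productPMF (fun _ => Q) y ≤ ENNReal.ofReal (K * Real.exp (-(n * c))) ∧
      ∀ x : Fin n → X, (∃ b, n * η ≤ |∑ i, (W (x i) b).toReal - n * (Q b).toReal|) →
        ∑ y ∈ Sᶜ, productPMF (fun i => W (x i)) y ≤
          ENNReal.ofReal (K * Real.exp (-(n * c))) := by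
  obtain ⟨c, hc, h⟩ := chernoff_abs (Y := Y) (half_pos hη)
  have hmean : ∀ (P : PMF Y) (b : Y),
      ∑ y, (P y).toReal * (if y = b then (1 : ℝ) else 0) = (P b).toReal := fun P b => by simp
  have habs : ∀ b y : Y, |if y = b then (1 : ℝ) else 0| ≤ 1 := fun b y => by
    split_ifs <;> simp
  -- The set consists of outputs in which the frequency of some letter is off from `Q` by at least
  -- `η / 2`. If a codeword's expected frequency is off by `η`, its output avoids the set only by
  -- deviating `η / 2` from its own mean.
  refine ⟨c, hc, 2 * (Fintype.card Y + 1), by linarith [(Fintype.card Y).cast_nonneg (α := ℝ)],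
    fun n => ⟨Finset.univ.biUnion fun b => Finset.univ.filter fun y : Fin n → Y =>
      n * (η / 2) ≤ |(∑ i, if y i = b then (1 : ℝ) else 0) - n * (Q b).toReal|, ?_, ?_⟩⟩
  · calc _ ≤ ∑ b, ∑ y : Fin n → Y with
          n * (η / 2) ≤ |(∑ i, if y i = b then (1 : ℝ) else 0) - n * (Q b).toReal|,
            productPMF (fun _ => Q) y :=
          ENNReal.sum_le_sum_sum (fun y hy => by simpa using hy) _
      _ ≤ ∑ _b : Y, 2 * ENNReal.ofReal (Real.exp (-(n * c))) := by
        refine Finset.sum_le_sum fun b _ => ?_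
        have := h (fun _ : Fin n => Q) (fun y => if y = b then (1 : ℝ) else 0) (habs b)
        simpa only [hmean, Finset.sum_const, Finset.card_univ, Fintype.card_fin, nsmul_eq_mul]
          using this
      _ = ENNReal.ofReal (2 * Fintype.card Y * Real.exp (-(n * c))) := by
        rw [Finset.sum_const, Finset.card_univ, nsmul_eq_mul,
          ENNReal.ofReal_mul (by positivity), ENNReal.ofReal_mul (by positivity)]
        simp only [ENNReal.ofReal_ofNat, ENNReal.ofReal_natCast]
        ring
      _ ≤ _ := ENNReal.ofReal_le_ofReal
        (mul_le_mul_of_nonneg_right (by linarith) (Real.exp_nonneg _))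
  · rintro x ⟨b, hb⟩
    have hx := h (fun i => W (x i)) (fun y => if y = b then (1 : ℝ) else 0) (habs b)
    simp only [hmean] at hx
    refine (Finset.sum_le_sum_of_subset ?_).trans (hx.trans ?_)
    · intro y hy
      simp only [Finset.mem_filter, Finset.mem_univ, true_and, Finset.mem_compl,
        Finset.mem_biUnion, not_exists,
        not_le] at hy ⊢
      have h1 := hy b
      have h2 := abs_sub_abs_le_abs_sub (∑ i, (W (x i) b).toReal - n * (Q b).toReal)
        ((∑ i, if y i = b then (1 : ℝ) else 0) - n * (Q b).toReal)
      rw [sub_sub_sub_cancel_right, abs_sub_comm (∑ i, (W (x i) b).toReal)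
        (∑ i, if y i = b then 1 else 0)] at h2
      linarith
    · rw [← ENNReal.ofReal_ofNat 2, ← ENNReal.ofReal_mul (by norm_num)]
      exact ENNReal.ofReal_le_ofReal (mul_le_mul_of_nonneg_right
        (by linarith [(Fintype.card Y).cast_nonneg (α := ℝ)]) (Real.exp_nonneg _))

end Inputs

/-! ### One-shot random coding -/

section RandomCoding

variable {A : Type w} [Fintype A]

/-- Independence: the `m`-th codeword is integrated separately from the remaining ones. -/
theorem sum_prod_insertNth {N : ℕ} (μ : A → ℝ) (m : Fin (N + 1)) (F : A → (Fin N → A) → ℝ) :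
    ∑ c : Fin (N + 1) → A, (∏ j, μ (c j)) * F (c m) (fun j => c (m.succAbove j)) =
      ∑ x, μ x * ∑ c : Fin N → A, (∏ j, μ (c j)) * F x c := by
  rw [← (Fin.insertNthEquiv (fun _ => A) m).sum_comp, Fintype.sum_prod_type]
  refine Finset.sum_congr rfl fun x _ => ?_
  rw [Finset.mul_sum]
  refine Finset.sum_congr rfl fun c _ => ?_
  simp [Fin.insertNthEquiv, Fin.prod_univ_succAbove _ m, mul_assoc]

theorem sum_prod_eq_one {N : ℕ} {μ : A → ℝ} (hμ1 : ∑ x, μ x = 1) :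
    ∑ c : Fin N → A, ∏ j, μ (c j) = 1 := by
  rw [Fintype.sum_prod_fin fun _ => μ]
  simp [hμ1]

theorem sum_prod_mul_sum {N : ℕ} {μ : A → ℝ} (hμ1 : ∑ x, μ x = 1) (a : A → ℝ) :
    ∑ c : Fin N → A, (∏ j, μ (c j)) * ∑ j, a (c j) = N * ∑ x, μ x * a x := by
  cases N with
  | zero => simp
  | succ N =>
    simp only [Finset.mul_sum]
    rw [Finset.sum_comm]
    have : ∀ m : Fin (N + 1), ∑ c : Fin (N + 1) → A, (∏ j, μ (c j)) * a (c m)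
        = ∑ x, μ x * a x := fun m => by
      rw [sum_prod_insertNth μ m fun x _ => a x]
      simp only [← Finset.sum_mul, sum_prod_eq_one hμ1, one_mul]
    simp only [this, Finset.sum_const, Finset.card_univ, Fintype.card_fin, nsmul_eq_mul,
      Finset.mul_sum]

/-- The moment of order `1 + s` of an empirical mean of independent nonnegative variables. -/
theorem sum_prod_mul_mean_rpow_le {s : ℝ} (hs : 0 < s) (hs1 : s ≤ 1) {μ a : A → ℝ}
    (hμ : ∀ x, 0 ≤ μ x) (hμ1 : ∑ x, μ x = 1) (ha : ∀ x, 0 ≤ a x) (M : ℕ) [NeZero M] :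
    ∑ c : Fin M → A, (∏ j, μ (c j)) * ((M : ℝ)⁻¹ * ∑ j, a (c j)) ^ (1 + s) ≤
      (M : ℝ) ^ (-s) * ∑ x, μ x * a x ^ (1 + s) + (∑ x, μ x * a x) ^ (1 + s) := by
  obtain ⟨N, rfl⟩ := Nat.exists_eq_succ_of_ne_zero (NeZero.ne M)
  set L : ℝ := ((N + 1 : ℕ) : ℝ) with hL
  have hL0 : 0 < L := by positivity
  set e := ∑ x, μ x * a x with he
  have he0 : 0 ≤ e := Finset.sum_nonneg fun x _ => mul_nonneg (hμ x) (ha x)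
  have hv : ∀ {k : ℕ} (c : Fin k → A), 0 ≤ ∏ j, μ (c j) := fun c =>
    Finset.prod_nonneg fun j _ => hμ _
  have hsplit : ∀ t : ℝ, 0 ≤ t → t ^ (1 + s) = t * t ^ s := fun t ht => by
    rw [Real.rpow_add_of_nonneg ht zero_le_one hs.le, Real.rpow_one]
  -- Jensen for the concave power `s`. The `N` remaining codewords are still weighted by `1 / (N +
  -- 1)`, so their mean is at most `e`.
  have hjensen : ∑ c : Fin N → A, (∏ j, μ (c j)) * (L⁻¹ * ∑ j, a (c j)) ^ s ≤ e ^ s := by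
    have h1 := (Real.concaveOn_rpow hs.le hs1).le_map_sum (t := Finset.univ)
      (w := fun c : Fin N → A => ∏ j, μ (c j)) (p := fun c => L⁻¹ * ∑ j, a (c j))
      (fun c _ => hv c) (sum_prod_eq_one hμ1)
      (fun c _ => mul_nonneg (inv_nonneg.2 hL0.le) (Finset.sum_nonneg fun j _ => ha _))
    simp only [smul_eq_mul] at h1
    refine h1.trans (Real.rpow_le_rpow (Finset.sum_nonneg fun c _ => mul_nonneg (hv c)
      (mul_nonneg (inv_nonneg.2 hL0.le) (Finset.sum_nonneg fun j _ => ha _))) ?_ hs.le)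
    simp only [mul_left_comm _ L⁻¹]
    rw [← Finset.mul_sum, sum_prod_mul_sum hμ1, ← he, ← mul_assoc]
    refine mul_le_of_le_one_left he0 ?_
    rw [inv_mul_le_iff₀ hL0, hL]
    push_cast
    linarith
  -- Writing `t^(1+s) = t * t^s`, subadditivity of the power `s ≤ 1` splits the second factor into
  -- the share of codeword `m` and that of the others, which are independent of it.
  have hterm : ∀ m : Fin (N + 1), ∑ c : Fin (N + 1) → A, (∏ j, μ (c j)) *
      (a (c m) * (L⁻¹ * ∑ j, a (c j)) ^ s) ≤ L ^ (-s) * ∑ x, μ x * a x ^ (1 + s) + e ^ (1 + s) := by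
    intro m
    calc _ ≤ ∑ c : Fin (N + 1) → A, (∏ j, μ (c j)) * (a (c m) *
            ((L⁻¹ * a (c m)) ^ s + (L⁻¹ * ∑ j, a (c (m.succAbove j))) ^ s)) := by
          refine Finset.sum_le_sum fun c _ => mul_le_mul_of_nonneg_left
            (mul_le_mul_of_nonneg_left ?_ (ha _)) (hv c)
          rw [Fin.sum_univ_succAbove _ m, mul_add]
          exact Real.rpow_add_le_add_rpow (mul_nonneg (inv_nonneg.2 hL0.le) (ha _))
            (mul_nonneg (inv_nonneg.2 hL0.le) (Finset.sum_nonneg fun j _ => ha _)) hs.le hs1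
      _ = ∑ x, μ x * ∑ c : Fin N → A, (∏ j, μ (c j)) *
            (a x * ((L⁻¹ * a x) ^ s + (L⁻¹ * ∑ j, a (c j)) ^ s)) :=
          sum_prod_insertNth μ m fun x c =>
            a x * ((L⁻¹ * a x) ^ s + (L⁻¹ * ∑ j, a (c j)) ^ s)
      _ = ∑ x, (L ^ (-s) * (μ x * a x ^ (1 + s)) + μ x * a x *
            ∑ c : Fin N → A, (∏ j, μ (c j)) * (L⁻¹ * ∑ j, a (c j)) ^ s) := by
          refine Finset.sum_congr rfl fun x _ => ?_
          simp only [mul_add, Finset.sum_add_distrib]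
          rw [← Finset.sum_mul, sum_prod_eq_one hμ1, hsplit _ (ha x),
            Real.mul_rpow (inv_nonneg.2 hL0.le) (ha x), Real.inv_rpow hL0.le,
            ← Real.rpow_neg hL0.le]
          simp only [mul_left_comm _ (a x), ← Finset.mul_sum]
          ring
      _ ≤ _ := by
          rw [Finset.sum_add_distrib, ← Finset.mul_sum, ← Finset.sum_mul, ← he, hsplit e he0]
          exact add_le_add_right (mul_le_mul_of_nonneg_left hjensen he0) _
  calc _ = ∑ c : Fin (N + 1) → A, ∑ m, L⁻¹ * ((∏ j, μ (c j)) *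
          (a (c m) * (L⁻¹ * ∑ j, a (c j)) ^ s)) := by
        refine Finset.sum_congr rfl fun c _ => ?_
        rw [hsplit _ (mul_nonneg (inv_nonneg.2 hL0.le) (Finset.sum_nonneg fun j _ => ha _)),
          ← Finset.mul_sum, ← Finset.mul_sum, ← Finset.sum_mul]
        ring
    _ = ∑ m, L⁻¹ * ∑ c : Fin (N + 1) → A, (∏ j, μ (c j)) *
          (a (c m) * (L⁻¹ * ∑ j, a (c j)) ^ s) := by
        rw [Finset.sum_comm]
        simp only [Finset.mul_sum]
    _ ≤ ∑ _m : Fin (N + 1), L⁻¹ * (L ^ (-s) * ∑ x, μ x * a x ^ (1 + s) + e ^ (1 + s)) :=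
        Finset.sum_le_sum fun m _ => mul_le_mul_of_nonneg_left (hterm m) (inv_nonneg.2 hL0.le)
    _ = _ := by
        rw [Finset.sum_const, Finset.card_univ, Fintype.card_fin, nsmul_eq_mul, ← hL,
          mul_inv_cancel_left₀ hL0.ne']

/-- Positive weight is recorded because the codewords are known to be absolutely continuous with
respect to `Q` only on the support of `μ`. -/
theorem exists_pos_le_of_sum_le {ι : Type*} [Fintype ι] {v F : ι → ℝ} {B : ℝ} (hv : ∀ i, 0 ≤ v i)
    (hv1 : ∑ i, v i = 1) (h : ∑ i, v i * F i ≤ B) : ∃ i, v i ≠ 0 ∧ F i ≤ B := by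
  by_contra! hcon
  obtain ⟨i, -, hi⟩ := Finset.exists_ne_zero_of_sum_ne_zero (hv1.trans_ne one_ne_zero)
  have : ∑ i, v i * B < ∑ i, v i * F i := by
    refine Finset.sum_lt_sum (fun j _ => ?_) ⟨i, Finset.mem_univ i, ?_⟩
    · by_cases hj : v j = 0
      · simp [hj]
      · exact mul_le_mul_of_nonneg_left (hcon j hj).le (hv j)
    · exact mul_lt_mul_of_pos_left (hcon i hi) (lt_of_le_of_ne (hv i) (Ne.symm hi))
  rw [← Finset.sum_mul, hv1, one_mul] at this
  linarith

/-- The mean over random codebooks of the sum in the Rényi divergence of order `1 + s`. -/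
theorem sum_codebook_rpow_le {B : Type v} [Fintype B] {s : ℝ} (hs : 0 < s) (hs1 : s ≤ 1)
    {V : A → B → ℝ} {q : B → ℝ} {μ : A → ℝ} {C : ℝ} (hV : ∀ x y, 0 ≤ V x y) (hq : ∀ y, 0 ≤ q y)
    (hq1 : ∑ y, q y = 1) (hμ : ∀ x, 0 ≤ μ x) (hμ1 : ∑ x, μ x = 1) (hC0 : 0 ≤ C)
    (hC : ∀ y, ∑ x, μ x * V x y ≤ C * q y) (M : ℕ) [NeZero M] :
    ∑ c : Fin M → A, (∏ j, μ (c j)) *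
        ∑ y, ((M : ℝ)⁻¹ * ∑ m, V (c m) y) ^ (1 + s) * q y ^ (-s) ≤
      (M : ℝ) ^ (-s) * ∑ x, μ x * (∑ y, V x y ^ (1 + s) * q y ^ (-s)) + C ^ (1 + s) := by
  have hq' : ∀ y, 0 ≤ q y ^ (-s) := fun y => Real.rpow_nonneg (hq y) _
  have h1 : ∀ y, ∑ c : Fin M → A, (∏ j, μ (c j)) *
        (((M : ℝ)⁻¹ * ∑ m, V (c m) y) ^ (1 + s) * q y ^ (-s)) ≤
      (M : ℝ) ^ (-s) * ∑ x, μ x * (V x y ^ (1 + s) * q y ^ (-s)) + C ^ (1 + s) * q y := by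
    intro y
    have h2 := sum_prod_mul_mean_rpow_le hs hs1 hμ hμ1 (fun x => hV x y) M
    have h3 : (∑ x, μ x * V x y) ^ (1 + s) ≤ C ^ (1 + s) * q y ^ (1 + s) := by
      rw [← Real.mul_rpow hC0 (hq y)]
      exact Real.rpow_le_rpow (Finset.sum_nonneg fun x _ => mul_nonneg (hμ x) (hV x y)) (hC y)
        (by linarith)
    have h4 : q y ^ (1 + s) * q y ^ (-s) ≤ q y := by
      by_cases hy : q y = 0
      · simp [hy, Real.zero_rpow (show 1 + s ≠ 0 by linarith)]
      · rw [← Real.rpow_add (lt_of_le_of_ne (hq y) (Ne.symm hy))]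
        simp
    calc _ = (∑ c : Fin M → A, (∏ j, μ (c j)) * ((M : ℝ)⁻¹ * ∑ m, V (c m) y) ^ (1 + s)) *
            q y ^ (-s) := by rw [Finset.sum_mul]; simp only [mul_assoc]
      _ ≤ ((M : ℝ) ^ (-s) * ∑ x, μ x * V x y ^ (1 + s) + C ^ (1 + s) * q y ^ (1 + s)) *
            q y ^ (-s) := mul_le_mul_of_nonneg_right (h2.trans (add_le_add_right h3 _)) (hq' y)
      _ = (M : ℝ) ^ (-s) * ∑ x, μ x * (V x y ^ (1 + s) * q y ^ (-s)) +
            C ^ (1 + s) * (q y ^ (1 + s) * q y ^ (-s)) := by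
          rw [add_mul, mul_assoc, Finset.sum_mul, mul_assoc]
          simp only [mul_assoc]
      _ ≤ _ := add_le_add_right
          (mul_le_mul_of_nonneg_left h4 (Real.rpow_nonneg hC0 _)) _
  calc _ = ∑ y, ∑ c : Fin M → A, (∏ j, μ (c j)) *
        (((M : ℝ)⁻¹ * ∑ m, V (c m) y) ^ (1 + s) * q y ^ (-s)) := by
        simp only [Finset.mul_sum]
        rw [Finset.sum_comm]
    _ ≤ _ := Finset.sum_le_sum fun y _ => h1 y
    _ = _ := by
        rw [Finset.sum_add_distrib, ← Finset.mul_sum, ← Finset.mul_sum, hq1, mul_one,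
          Finset.sum_comm]
        simp only [Finset.mul_sum]

/-- Existence of a codebook of `M` codewords whose output distribution is close to `Q` in the
sense of the Rényi divergence of order `1 + s`. -/
theorem exists_codebook_renyiSum_le {B : Type v} [Fintype B] {s : ℝ} (hs : 0 < s) (hs1 : s ≤ 1)
    {V : A → PMF B} {Q : PMF B} {μ : A → ℝ} {G C : ℝ} (hμ : ∀ x, 0 ≤ μ x) (hμ1 : ∑ x, μ x = 1)
    (hV : ∀ x, μ x ≠ 0 → ∀ y, Q y = 0 → V x y = 0)
    (hG : ∀ x, μ x ≠ 0 → densityMGF (V x) Q s ≤ G) (hC0 : 0 ≤ C)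
    (hC : ∀ y, ∑ x, μ x * (V x y).toReal ≤ C * (Q y).toReal) (M : ℕ) [NeZero M] :
    ∃ c : Fin M → A,
      renyiSum s ((PMF.uniformOfFintype (Fin M)).bind fun m => V (c m)) Q ≤
        ENNReal.ofReal ((M : ℝ) ^ (-s) * G + C ^ (1 + s)) := by
  have hs' : -1 < s := by linarith
  have hout : ∀ (c : Fin M → A) y,
      (((PMF.uniformOfFintype (Fin M)).bind fun m => V (c m)) y).toReal
        = (M : ℝ)⁻¹ * ∑ m, (V (c m) y).toReal := fun c y => by
    rw [PMF.bind_apply_fintype, ENNReal.toReal_sum fun m _ =>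
      ENNReal.mul_ne_top (PMF.apply_ne_top _ _) (PMF.apply_ne_top _ _), Finset.mul_sum]
    simp
  have hmean := sum_codebook_rpow_le hs hs1 (V := fun x y => (V x y).toReal)
    (q := fun y => (Q y).toReal) (fun x y => ENNReal.toReal_nonneg)
    (fun y => ENNReal.toReal_nonneg) Q.sum_toReal hμ hμ1 hC0 hC M
  have hG' : ∑ x, μ x * (∑ y, (V x y).toReal ^ (1 + s) * (Q y).toReal ^ (-s)) ≤ G := by
    calc _ ≤ ∑ x, μ x * G := Finset.sum_le_sum fun x _ => by
          by_cases hx : μ x = 0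
          · simp [hx]
          · rw [← densityMGF_eq_sum_rpow hs' (hV x hx)]
            exact mul_le_mul_of_nonneg_left (hG x hx) (hμ x)
      _ = G := by rw [← Finset.sum_mul, hμ1, one_mul]
  obtain ⟨c, hc, hcB⟩ := exists_pos_le_of_sum_le
    (fun c : Fin M → A => Finset.prod_nonneg fun j _ => hμ (c j)) (sum_prod_eq_one hμ1) hmean
  refine ⟨c, ?_⟩
  have hac : ∀ y, Q y = 0 → ((PMF.uniformOfFintype (Fin M)).bind fun m => V (c m)) y = 0 := by
    intro y hy
    rw [PMF.bind_apply_fintype]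
    refine Finset.sum_eq_zero fun m _ => ?_
    rw [hV (c m) (fun h0 => hc (Finset.prod_eq_zero (Finset.mem_univ m) h0)) y hy, mul_zero]
  rw [renyiSum_eq_ofReal hs' hac, densityMGF_eq_sum_rpow hs' hac]
  simp only [hout]
  refine ENNReal.ofReal_le_ofReal (hcB.trans (add_le_add_left
    (mul_le_mul_of_nonneg_left hG' (by positivity)) _))

end RandomCoding

/-! ### Vanishing rates -/

theorem renyiSum_productPMF {Y : Type v} [Fintype Y] {n : ℕ} {s : ℝ} (hs : -1 < s)
    (p q : Fin n → PMF Y) :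
    renyiSum s (productPMF p) (productPMF q) = ∏ i, renyiSum s (p i) (q i) := by
  simp only [renyiSum]
  rw [← Fintype.sum_prod_fin fun i y => p i y ^ (1 + s) * q i y ^ (-s)]
  refine Finset.sum_congr rfl fun y _ => ?_
  rw [Finset.prod_mul_distrib, productPMF_apply, productPMF_apply,
    ENNReal.prod_rpow_of_nonneg (by linarith), ENNReal.prod_rpow_of_ne_top
      fun i _ => (q i).apply_ne_top _]

theorem densityMGF_productPMF {Y : Type v} [Fintype Y] {n : ℕ} {s : ℝ} (hs : -1 < s)
    {p q : Fin n → PMF Y} (h : ∀ i y, q i y = 0 → p i y = 0) :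
    densityMGF (productPMF p) (productPMF q) s = ∏ i, densityMGF (p i) (q i) s := by
  have hac : ∀ y, productPMF q y = 0 → productPMF p y = 0 := fun y hy => by
    rw [productPMF_apply, Finset.prod_eq_zero_iff] at hy ⊢
    obtain ⟨i, hi, hqi⟩ := hy
    exact ⟨i, hi, h i _ hqi⟩
  have := renyiSum_productPMF hs p q
  rw [renyiSum_eq_ofReal hs hac, Finset.prod_congr rfl fun i _ => renyiSum_eq_ofReal hs (h i),
    ← ENNReal.ofReal_prod_of_nonneg fun i _ => (densityMGF_pos _ _ s).le] at this
  exact (ENNReal.ofReal_eq_ofReal_iff (densityMGF_pos _ _ s).le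
    (Finset.prod_nonneg fun i _ => (densityMGF_pos _ _ s).le)).1 this

section Rates

variable {X : Type u} {Y : Type v} [Fintype Y]

theorem optimalDiscrepancy_nonneg {D : ∀ (A : Type v) [Fintype A], PMF A → PMF A → EReal}
    (hD : ∀ (A : Type v) [Fintype A] (P P' : PMF A), 0 ≤ D A P P') (W : X → PMF Y) (Q : PMF Y)
    (n M : ℕ) [NeZero M] : 0 ≤ optimalDiscrepancy D W Q n M :=
  le_iInf fun _ => le_iInf fun _ => le_iInf fun _ => hD _ _ _

theorem optimalDiscrepancy_le (D : ∀ (A : Type v) [Fintype A], PMF A → PMF A → EReal)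
    {W : X → PMF Y} {Q : PMF Y} {n M : ℕ} [NeZero M] {k : ℕ} (PU : PMF (Fin k))
    (f : Fin k → Fin M → Fin n → X) :
    optimalDiscrepancy D W Q n M ≤ D (Fin k × (Fin n → Y))
      (jointPMF PU fun u => codeOutput W (f u)) (jointPMF PU fun _ => productPMF fun _ => Q) :=
  iInf_le_of_le k (iInf_le_of_le PU (iInf_le _ f))

theorem mem_vanishingRates_of_le {D : ∀ (A : Type v) [Fintype A], PMF A → PMF A → EReal}
    (hD : ∀ (A : Type v) [Fintype A] (P P' : PMF A), 0 ≤ D A P P') {W : X → PMF Y} {Q : PMF Y}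
    {R : ℝ} (hR : 0 < R) (C : ℝ)
    (h : ∀ᶠ n in atTop, optimalDiscrepancy D W Q n (numMessages n R) ≤ C) :
    R ∈ vanishingRates D W Q := by
  refine ⟨hR, tendsto_of_tendsto_of_tendsto_of_le_of_le' tendsto_const_nhds
    (h := fun n : ℕ => (((n : ℝ)⁻¹ * C : ℝ) : EReal)) ?_ (Eventually.of_forall fun n => ?_) ?_⟩
  · have : Tendsto (fun n : ℕ => (n : ℝ)⁻¹ * C) atTop (𝓝 (0 * C)) :=
      tendsto_natCast_atTop_atTop.inv_tendsto_atTop.mul_const C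
    rw [zero_mul] at this
    exact_mod_cast (continuous_coe_real_ereal.tendsto 0).comp this
  · exact mul_nonneg (EReal.coe_nonneg.2 (by positivity))
      (optimalDiscrepancy_nonneg hD W Q n _)
  · filter_upwards [h] with n hn
    rw [EReal.coe_mul]
    exact mul_le_mul_of_nonneg_left hn (EReal.coe_nonneg.2 (by positivity))

theorem vanishingRates_subset {D D' : ∀ (A : Type v) [Fintype A], PMF A → PMF A → EReal}
    (hD : ∀ (A : Type v) [Fintype A] (P P' : PMF A), 0 ≤ D A P P')
    (hDD' : ∀ (A : Type v) [Fintype A] (P P' : PMF A), D A P P' ≤ D' A P P')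
    (W : X → PMF Y) (Q : PMF Y) : vanishingRates D' W Q ⊆ vanishingRates D W Q := by
  rintro R ⟨hR, h⟩
  refine ⟨hR, tendsto_of_tendsto_of_tendsto_of_le_of_le tendsto_const_nhds h (fun n => ?_)
    fun n => ?_⟩
  · exact mul_nonneg (EReal.coe_nonneg.2 (by positivity))
      (optimalDiscrepancy_nonneg hD W Q n _)
  · exact mul_le_mul_of_nonneg_left
      (iInf_mono fun k => iInf_mono fun PU => iInf_mono fun f => hDD' _ _ _)
      (EReal.coe_nonneg.2 (by positivity))

theorem eventually_exists_lt {D : ∀ (A : Type v) [Fintype A], PMF A → PMF A → EReal}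
    {W : X → PMF Y} {Q : PMF Y} {R : ℝ} (hR : R ∈ vanishingRates D W Q) {ε : ℝ} (hε : 0 < ε) :
    ∀ᶠ n in atTop, 0 < n ∧ ∃ (k : ℕ) (PU : PMF (Fin k))
      (f : Fin k → Fin (numMessages n R) → Fin n → X),
      D (Fin k × (Fin n → Y)) (jointPMF PU fun u => codeOutput W (f u))
        (jointPMF PU fun _ => productPMF fun _ => Q) < ((n * ε : ℝ) : EReal) := by
  have h := hR.2.eventually_lt_const (u := (ε : EReal)) (by exact_mod_cast hε)
  filter_upwards [h, eventually_gt_atTop 0] with n hn hn0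
  refine ⟨hn0, ?_⟩
  have hn' : (0 : ℝ) < n := by exact_mod_cast hn0
  have : optimalDiscrepancy D W Q n (numMessages n R) < ((n * ε : ℝ) : EReal) := by
    by_contra! hle
    have h1 := mul_le_mul_of_nonneg_left hle
      (show (0 : EReal) ≤ (((n : ℝ)⁻¹ : ℝ) : EReal) by exact_mod_cast (inv_pos.2 hn').le)
    rw [← EReal.coe_mul, inv_mul_cancel_left₀ hn'.ne'] at h1
    exact absurd (h1.trans_lt hn) (lt_irrefl _)
  simpa only [optimalDiscrepancy, iInf_lt_iff] using this

theorem renyiRates_zero_subset {s : ℝ} (hs : -1 < s) (hs0 : s ≤ 0) (W : X → PMF Y) (Q : PMF Y) :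
    renyiRates 0 W Q ⊆ renyiRates s W Q := by
  rcases hs0.eq_or_lt with rfl | h
  · exact subset_rfl
  · exact vanishingRates_subset (fun A _ P P' => renyiDiv_nonneg hs P P')
      (fun A _ P P' => renyiDiv_le_zero hs h P P') W Q

theorem renyiRates_subset_zero {s : ℝ} (hs : 0 < s) (W : X → PMF Y) (Q : PMF Y) :
    renyiRates s W Q ⊆ renyiRates 0 W Q :=
  vanishingRates_subset (fun A _ P P' => renyiDiv_nonneg (by norm_num) P P')
    (fun A _ P P' => renyiDiv_zero_le hs P P') W Q

theorem exp_le_numMessages (n : ℕ) (R : ℝ) : Real.exp (n * R) ≤ numMessages n R := Nat.le_ceil _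

theorem numMessages_le {n : ℕ} {R : ℝ} (hR : 0 < R) :
    (numMessages n R : ℝ) ≤ 2 * Real.exp (n * R) := by
  have h1 := (Nat.ceil_lt_add_one (Real.exp_nonneg (n * R))).le
  have h2 : 1 ≤ Real.exp (n * R) := Real.one_le_exp (by positivity)
  exact h1.trans (by linarith)

theorem optimalDiscrepancy_renyiDiv_le {s B : ℝ} (hs : 0 < s) (hB : 0 < B) {W : X → PMF Y}
    {Q : PMF Y} {n M : ℕ} [NeZero M] (c : Fin M → Fin n → X)
    (h : renyiSum s (codeOutput W c) (productPMF fun _ => Q) ≤ ENNReal.ofReal B) :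
    optimalDiscrepancy (fun _ _ P P' => renyiDiv s P P') W Q n M ≤
      ((s⁻¹ * Real.log B : ℝ) : EReal) := by
  refine (optimalDiscrepancy_le _ (PMF.pure (0 : Fin 1)) fun _ => c).trans ?_
  rw [renyiDiv_of_ne_zero hs.ne', renyiSum_jointPMF (by linarith), ← Finset.sum_mul,
    PMF.sum_coe, one_mul, EReal.coe_mul, ← ENNReal.log_ofReal_of_pos hB]
  exact mul_le_mul_of_nonneg_left (ENNReal.log_le_log h) (by exact_mod_cast (inv_pos.2 hs).le)

end Rates

/-! ### Achievability -/

section Achievability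

variable {X : Type u} {Y : Type v} [Fintype X] [Fintype Y]

theorem eventually_half_le_typical (P : PMF X) {d : X → ℝ} {ρ : ℝ}
    (hρ : ∑ x, (P x).toReal * d x < ρ) :
    ∀ᶠ n : ℕ in atTop, 1 / 2 ≤
      ∑ x : Fin n → X with ∑ i, d (x i) < n * ρ, ∏ i, (P (x i)).toReal := by
  obtain ⟨c, hc, h⟩ := chernoff (Y := X) (B := ∑ x, |d x|)
    (Finset.sum_nonneg fun x _ => abs_nonneg _) (sub_pos.2 hρ)
  have hlim : Tendsto (fun n : ℕ => Real.exp (-(n * c))) atTop (𝓝 0) :=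
    Real.tendsto_exp_neg_atTop_nhds_zero.comp (tendsto_natCast_atTop_atTop.atTop_mul_const hc)
  filter_upwards [hlim.eventually_le_const (show (0 : ℝ) < 1 / 2 by norm_num)] with n hn
  have h1 := h (fun _ : Fin n => P) (fun _ => d) fun _ x =>
    Finset.single_le_sum (f := fun x => |d x|) (fun x _ => abs_nonneg _) (Finset.mem_univ x)
  rw [ENNReal.le_ofReal_iff_toReal_le
    (ENNReal.sum_ne_top.2 fun y _ => PMF.apply_ne_top _ _) (Real.exp_nonneg _),
    ENNReal.toReal_sum fun y _ => PMF.apply_ne_top _ _] at h1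
  have h2 := Finset.sum_filter_add_sum_filter_not Finset.univ
    (fun x : Fin n → X => ∑ i, d (x i) < n * ρ) fun x => ∏ i, (P (x i)).toReal
  rw [sum_prod_eq_one P.sum_toReal] at h2
  have h3 : ∑ x : Fin n → X with ¬ ∑ i, d (x i) < n * ρ, ∏ i, (P (x i)).toReal ≤
      Real.exp (-(n * c)) := by
    refine le_trans (le_of_eq ?_) h1
    refine Finset.sum_congr ?_ fun x _ => ?_
    · ext x
      simp only [Finset.mem_filter, Finset.mem_univ, true_and, not_lt, Finset.sum_const,
        Finset.card_univ, Fintype.card_fin, nsmul_eq_mul]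
      rw [mul_sub, add_sub_cancel]
    · rw [productPMF_apply, ENNReal.toReal_prod]
  linarith

/-- Random coding from `P^n` conditioned on `T`, the codewords of total divergence below `nR`; by
concentration `T` eventually has probability `Z ≥ 1/2`. -/
theorem mem_renyiRates_of_lt {W : X → PMF Y} {Q : PMF Y} {P : PMF X} (hP : P ∈ inputDists W Q)
    {s R : ℝ} (hs : 0 < s) (hs1 : s ≤ 1) (hR : 0 < R)
    (h : ∑ x, (P x).toReal * (s⁻¹ * Real.log (densityMGF (W x) Q s)) < R) :
    R ∈ renyiRates s W Q := by
  classical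
  have hs' : -1 < s := by linarith
  refine mem_vanishingRates_of_le (fun A _ P P' => renyiDiv_nonneg hs' P P') hR
    (s⁻¹ * Real.log (1 + 2 ^ (1 + s))) ?_
  filter_upwards [eventually_half_le_typical P h] with n hn
  set d : X → ℝ := fun x => s⁻¹ * Real.log (densityMGF (W x) Q s) with hd
  set T : Finset (Fin n → X) := Finset.univ.filter fun x => ∑ i, d (x i) < n * R with hT
  set Z := ∑ x ∈ T, ∏ i, (P (x i)).toReal with hZ
  have hZ0 : 0 < Z := by linarith
  have hp : ∀ x : Fin n → X, 0 ≤ ∏ i, (P (x i)).toReal := fun x =>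
    Finset.prod_nonneg fun i _ => ENNReal.toReal_nonneg
  set μ : (Fin n → X) → ℝ := fun x => if x ∈ T then Z⁻¹ * ∏ i, (P (x i)).toReal else 0 with hμ
  have hμT : ∀ x, μ x ≠ 0 → x ∈ T ∧ ∀ i, P (x i) ≠ 0 := fun x hx => by
    simp only [hμ, ne_eq, ite_eq_right_iff, not_forall] at hx
    obtain ⟨hxT, hx⟩ := hx
    refine ⟨hxT, fun i hi => hx ?_⟩
    rw [Finset.prod_eq_zero (Finset.mem_univ i) (by rw [hi, ENNReal.toReal_zero]), mul_zero]
  have hμac : ∀ x, μ x ≠ 0 → ∀ i y, Q y = 0 → W (x i) y = 0 := fun x hx i y hy =>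
    channel_eq_zero hP ((hμT x hx).2 i) hy
  -- `G` is the cap on the moment imposed by `T`, and `C = 2` bounds the factor `Z⁻¹` lost by
  -- conditioning.
  obtain ⟨c, hc⟩ := exists_codebook_renyiSum_le hs hs1
    (V := fun x : Fin n → X => productPMF fun i => W (x i)) (Q := productPMF fun _ => Q)
    (μ := μ) (G := Real.exp (s * (n * R))) (C := 2)
    (fun x => by
      simp only [hμ]
      split_ifs
      exacts [mul_nonneg (inv_nonneg.2 hZ0.le) (hp x), le_rfl])
    (by simp only [hμ]
        rw [Finset.sum_ite_mem, Finset.univ_inter, ← Finset.mul_sum, inv_mul_cancel₀ hZ0.ne'])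
    (fun x hx y hy => by
      rw [productPMF_apply, Finset.prod_eq_zero_iff] at hy ⊢
      obtain ⟨i, hi, hyi⟩ := hy
      exact ⟨i, hi, hμac x hx i _ hyi⟩)
    (fun x hx => by
      rw [densityMGF_productPMF hs' (hμac x hx)]
      have hdi : ∀ i, densityMGF (W (x i)) Q s = Real.exp (s * d (x i)) := fun i => by
        rw [hd, mul_inv_cancel_left₀ hs.ne', Real.exp_log (densityMGF_pos _ _ s)]
      simp only [hdi]
      rw [← Real.exp_sum, ← Finset.mul_sum, Real.exp_le_exp]
      exact mul_le_mul_of_nonneg_left (Finset.mem_filter.1 (hμT x hx).1).2.le hs.le)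
    zero_le_two
    (fun y => by
      calc ∑ x, μ x * (productPMF (fun i => W (x i)) y).toReal
          ≤ ∑ x : Fin n → X, Z⁻¹ * ∏ i, ((P (x i)).toReal * (W (x i) (y i)).toReal) := by
            refine Finset.sum_le_sum fun x _ => ?_
            rw [productPMF_apply, ENNReal.toReal_prod, Finset.prod_mul_distrib, ← mul_assoc]
            refine mul_le_mul_of_nonneg_right ?_
              (Finset.prod_nonneg fun i _ => ENNReal.toReal_nonneg)
            simp only [hμ]
            split_ifs
            exacts [le_rfl, mul_nonneg (inv_nonneg.2 hZ0.le) (hp x)]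
        _ = Z⁻¹ * (productPMF (fun _ => Q) y).toReal := by
            rw [← Finset.mul_sum,
              Fintype.sum_prod_fin fun i a => (P a).toReal * (W a (y i)).toReal]
            simp only [mem_inputDists_iff.1 hP]
            rw [productPMF_apply, ENNReal.toReal_prod]
        _ ≤ _ := by
            refine mul_le_mul_of_nonneg_right ?_ ENNReal.toReal_nonneg
            rw [inv_le_comm₀ hZ0 two_pos]
            linarith)
    (numMessages n R)
  refine optimalDiscrepancy_renyiDiv_le hs (by positivity) c (hc.trans
    (ENNReal.ofReal_le_ofReal (add_le_add_left ?_ _)))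
  have hM := exp_le_numMessages n R
  rw [Real.rpow_neg (Nat.cast_nonneg _), inv_mul_le_iff₀
    (Real.rpow_pos_of_pos ((Real.exp_pos _).trans_le hM) s), mul_one, mul_comm s, Real.exp_mul]
  exact Real.rpow_le_rpow (Real.exp_nonneg _) hM hs.le

/-- The Rényi divergence of order `1 + s` tends to the relative entropy as `s → 0`. -/
theorem tendsto_inv_mul_log_densityMGF {A : Type w} [Fintype A] (P Q : PMF A) :
    Tendsto (fun s : ℝ => s⁻¹ * Real.log (densityMGF P Q s)) (𝓝[>] 0) (𝓝 (densityMean P Q)) := by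
  have h0 : densityMGF P Q 0 = 1 := by simp [densityMGF, P.sum_toReal]
  have h1 : HasDerivAt (densityMGF P Q) (densityMean P Q) 0 := by
    unfold densityMGF densityMean
    refine HasDerivAt.fun_sum fun x _ => ?_
    have := ((hasDerivAt_id (0 : ℝ)).mul_const
      (Real.log ((P x).toReal / (Q x).toReal))).exp.const_mul (P x).toReal
    simpa using this
  have h2 := h1.log (by rw [h0]; exact one_ne_zero)
  rw [h0, div_one] at h2
  have h3 := h2.tendsto_slope_zero_right
  simpa [h0] using h3

theorem mem_renyiRates_zero_of_lt {W : X → PMF Y} {Q : PMF Y} {P : PMF X}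
    (hP : P ∈ inputDists W Q) {R : ℝ} (hR : 0 < R)
    (h : ∑ x, (P x).toReal * densityMean (W x) Q < R) : R ∈ renyiRates 0 W Q := by
  have hlim : Tendsto (fun s : ℝ => ∑ x, (P x).toReal * (s⁻¹ * Real.log (densityMGF (W x) Q s)))
      (𝓝[>] 0) (𝓝 (∑ x, (P x).toReal * densityMean (W x) Q)) :=
    tendsto_finsetSum _ fun x _ => (tendsto_inv_mul_log_densityMGF (W x) Q).const_mul _
  obtain ⟨s, hs, hs0, hs1⟩ := ((hlim.eventually_lt_const h).and
    (Ioc_mem_nhdsGT (zero_lt_one' ℝ))).exists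
  exact renyiRates_subset_zero hs0 W Q (mem_renyiRates_of_lt hP hs0 hs1 hR hs)

end Achievability

/-! ### Converse for orders below one -/

section Converse

theorem lt_renyiSum_of_renyiDiv_lt {A : Type w} [Fintype A] {s t : ℝ} (hs : s < 0) {P Q : PMF A}
    (h : renyiDiv s P Q < (t : EReal)) : ENNReal.ofReal (Real.exp (s * t)) < renyiSum s P Q := by
  by_contra! hle
  have h1 := ENNReal.log_le_log hle
  rw [ENNReal.log_ofReal_of_pos (Real.exp_pos _), Real.log_exp] at h1
  have h2 : (((-s)⁻¹ : ℝ) : EReal) * ENNReal.log (renyiSum s P Q) ≤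
      (((-s)⁻¹ : ℝ) : EReal) * ((s * t : ℝ) : EReal) :=
    mul_le_mul_of_nonneg_left h1 (EReal.coe_nonneg.2 (inv_nonneg.2 (by linarith)))
  rw [← EReal.coe_mul, inv_neg, neg_mul, inv_mul_cancel_left₀ hs.ne, EReal.coe_neg, EReal.coe_neg,
    EReal.neg_mul, EReal.neg_le_neg_iff, ← renyiDiv_of_ne_zero hs.ne] at h2
  exact absurd (h2.trans_lt h) (lt_irrefl _)

theorem renyiSum_lt_of_renyiDiv_lt {A : Type w} [Fintype A] {s t : ℝ} (hs : 0 < s) {P Q : PMF A}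
    (h : renyiDiv s P Q < (t : EReal)) : renyiSum s P Q < ENNReal.ofReal (Real.exp (s * t)) := by
  by_contra! hle
  have h1 := ENNReal.log_le_log hle
  rw [ENNReal.log_ofReal_of_pos (Real.exp_pos _), Real.log_exp] at h1
  have h2 : ((s⁻¹ : ℝ) : EReal) * ((s * t : ℝ) : EReal) ≤
      ((s⁻¹ : ℝ) : EReal) * ENNReal.log (renyiSum s P Q) :=
    mul_le_mul_of_nonneg_left h1 (EReal.coe_nonneg.2 (inv_nonneg.2 hs.le))
  rw [← EReal.coe_mul, inv_mul_cancel_left₀ hs.ne', ← renyiDiv_of_ne_zero hs.ne'] at h2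
  exact absurd (h2.trans_lt h) (lt_irrefl _)

variable {X : Type u} {Y : Type v} [Fintype Y]

theorem sum_codeOutput (W : X → PMF Y) {n M : ℕ} [NeZero M] (f : Fin M → Fin n → X)
    (S : Finset (Fin n → Y)) :
    ∑ y ∈ S, codeOutput W f y = ∑ m, (M : ℝ≥0∞)⁻¹ * ∑ y ∈ S, productPMF (fun i => W (f m i)) y := by
  simp only [codeOutput_apply, Finset.mul_sum]
  exact Finset.sum_comm

theorem sum_inv_mul_const (M : ℕ) [NeZero M] (a : ℝ≥0∞) :
    ∑ _m : Fin M, (M : ℝ≥0∞)⁻¹ * a = a := by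
  rw [Finset.sum_const, Finset.card_univ, Fintype.card_fin, nsmul_eq_mul, ← mul_assoc,
    ENNReal.mul_inv_cancel (by exact_mod_cast NeZero.ne M) (ENNReal.natCast_ne_top M), one_mul]

/-- The output sequences whose likelihood under a codeword exceeds `exp a` times the likelihood under
`Q ^ n` have small probability under `Q ^ n`. -/
theorem sum_likelihood_ratio_le {A : Type w} [Fintype A] (P Q : PMF A) {a : ℝ} (S : Finset A)
    (hS : ∀ y ∈ S, ENNReal.ofReal (Real.exp a) * Q y ≤ P y) :
    ∑ y ∈ S, Q y ≤ ENNReal.ofReal (Real.exp (-a)) := by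
  have h1 : ENNReal.ofReal (Real.exp (-a)) * ENNReal.ofReal (Real.exp a) = 1 := by
    rw [← ENNReal.ofReal_mul (Real.exp_nonneg _), ← Real.exp_add]
    simp
  calc ∑ y ∈ S, Q y = ENNReal.ofReal (Real.exp (-a)) *
          ∑ y ∈ S, ENNReal.ofReal (Real.exp a) * Q y := by
        rw [← Finset.mul_sum, ← mul_assoc, h1, one_mul]
    _ ≤ ENNReal.ofReal (Real.exp (-a)) * ∑ y, P y := by
        gcongr
        exact (Finset.sum_le_sum hS).trans (Finset.sum_le_sum_of_subset (Finset.subset_univ S))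
    _ = _ := by rw [P.sum_coe, mul_one]

variable [Fintype X]

open Classical in
/-- Concentration of the likelihood ratio of a codeword. -/
theorem exists_likelihood_ratio_concentration (W : X → PMF Y) (Q : PMF Y) {δ : ℝ} (hδ : 0 < δ) :
    ∃ c > 0, ∀ {n : ℕ} (x : Fin n → X) (a : ℝ), n * a ≤ ∑ i, densityMean (W (x i)) Q - n * δ →
      ∑ y ∈ (Finset.univ.filter fun y : Fin n → Y => ENNReal.ofReal (Real.exp (n * a)) *
          productPMF (fun _ => Q) y ≤ productPMF (fun i => W (x i)) y)ᶜ,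
        productPMF (fun i => W (x i)) y ≤ ENNReal.ofReal (Real.exp (-(n * c))) := by
  set ℓ : X → Y → ℝ := fun x y => Real.log ((W x y).toReal / (Q y).toReal) with hℓ
  obtain ⟨c, hc, h⟩ := chernoff (Y := Y) (B := ∑ x, ∑ y, |ℓ x y|)
    (Finset.sum_nonneg fun x _ => Finset.sum_nonneg fun y _ => abs_nonneg _) hδ
  refine ⟨c, hc, fun {n} x a ha => ?_⟩
  have h1 := h (fun i => W (x i)) (fun i y => -ℓ (x i) y) fun i y => by
    rw [abs_neg]
    exact (Finset.single_le_sum (f := fun y => |ℓ (x i) y|) (fun y _ => abs_nonneg _)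
      (Finset.mem_univ y)).trans (Finset.single_le_sum (f := fun x => ∑ y, |ℓ x y|)
        (fun x _ => Finset.sum_nonneg fun y _ => abs_nonneg _) (Finset.mem_univ (x i)))
  refine (Finset.sum_le_sum_of_ne_zero fun y hy hWy => ?_).trans h1
  rw [Finset.mem_compl, Finset.mem_filter, not_and] at hy
  have hy := not_le.1 (hy (Finset.mem_univ y))
  have hW : ∀ i, 0 < (W (x i) (y i)).toReal := fun i => by
    refine ENNReal.toReal_pos (fun h0 => hWy ?_) (PMF.apply_ne_top _ _)
    rw [productPMF_apply, Finset.prod_eq_zero (Finset.mem_univ i) h0]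
  -- A vanishing `Q` would make the strict upper bound on the likelihood zero. Hence every logarithm
  -- is a genuine one here, and the default value `log 0 = 0` does no harm.
  have hQ : ∀ i, 0 < (Q (y i)).toReal := fun i => by
    refine ENNReal.toReal_pos (fun h0 => not_lt_bot (a := productPMF (fun i => W (x i)) y) ?_)
      (PMF.apply_ne_top _ _)
    rw [productPMF_apply (fun _ => Q), Finset.prod_eq_zero (Finset.mem_univ i) h0, mul_zero] at hy
    exact hy
  rw [← ENNReal.toReal_lt_toReal (PMF.apply_ne_top _ _)
    (ENNReal.mul_ne_top ENNReal.ofReal_ne_top (PMF.apply_ne_top _ _)), ENNReal.toReal_mul,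
    ENNReal.toReal_ofReal (Real.exp_nonneg _), productPMF_apply, productPMF_apply,
    ENNReal.toReal_prod, ENNReal.toReal_prod, ← div_lt_iff₀ (Finset.prod_pos fun i _ => hQ i),
    ← Finset.prod_div_distrib, ← Real.log_lt_iff_lt_exp
      (Finset.prod_pos fun i _ => div_pos (hW i) (hQ i)),
    Real.log_prod fun i _ => (div_pos (hW i) (hQ i)).ne'] at hy
  simp only [Finset.mem_filter, Finset.mem_univ, true_and, mul_neg, Finset.sum_neg_distrib]
  have : ∀ i, ∑ b, (W (x i) b).toReal * ℓ (x i) b = densityMean (W (x i)) Q := fun i => rfl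
  simp only [this]
  have h2 : ∑ i, ℓ (x i) (y i) < n * a := hy
  linarith

open Classical in
/-- If the rate is below the minimal mutual information `r`, then every code has an output
distribution that is exponentially close to being singular to `Q ^ n`. -/
theorem exists_separating_set {W : X → PMF Y} {Q : PMF Y} {r δ η : ℝ} (hδ : 0 < δ) (hη : 0 < η)
    (hr : ∀ t ∈ stdSimplex ℝ X, (∀ y, |∑ x, t x * (W x y).toReal - (Q y).toReal| < η) →
      r - δ ≤ ∑ x, t x * densityMean (W x) Q) :
    ∃ c > 0, ∃ K : ℝ, 1 ≤ K ∧ ∀ n : ℕ, 0 < n → ∀ (M : ℕ) [NeZero M] (f : Fin M → Fin n → X),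
      ∃ G : Finset (Fin n → Y),
        ∑ y ∈ G, productPMF (fun _ => Q) y ≤
          ENNReal.ofReal (K * Real.exp (-(n * c)) + M * Real.exp (-(n * (r - 2 * δ)))) ∧
        ∑ y ∈ Gᶜ, codeOutput W f y ≤ ENNReal.ofReal (K * Real.exp (-(n * c))) := by
  obtain ⟨c₁, hc₁, K, hK, h1⟩ := exists_atypical W Q hη
  obtain ⟨c₂, hc₂, h2⟩ := exists_likelihood_ratio_concentration W Q hδ
  refine ⟨min c₁ c₂, lt_min hc₁ hc₂, K, hK, fun n hn M _ f => ?_⟩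
  have hexp : ∀ c', min c₁ c₂ ≤ c' → Real.exp (-(n * c')) ≤ Real.exp (-(n * min c₁ c₂)) :=
    fun c' hc' => Real.exp_le_exp.2 (neg_le_neg (mul_le_mul_of_nonneg_left hc' n.cast_nonneg))
  obtain ⟨S₀, hS₀, hfar⟩ := h1 n
  set T : (Fin n → X) → Finset (Fin n → Y) := fun x => Finset.univ.filter fun y : Fin n → Y =>
    ENNReal.ofReal (Real.exp (n * (r - 2 * δ))) * productPMF (fun _ => Q) y ≤
      productPMF (fun i => W (x i)) y with hT
  set G := S₀ ∪ Finset.univ.biUnion fun m => T (f m) with hG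
  refine ⟨G, ?_, ?_⟩
  · calc _ ≤ ∑ y ∈ S₀, productPMF (fun _ => Q) y +
          ∑ m, ∑ y ∈ T (f m), productPMF (fun _ => Q) y :=
        (ENNReal.sum_union_le _ _ _).trans (add_le_add_right
          (ENNReal.sum_le_sum_sum (fun y hy => by simpa using hy) _) _)
      _ ≤ ENNReal.ofReal (K * Real.exp (-(n * min c₁ c₂))) +
          ∑ _m : Fin M, ENNReal.ofReal (Real.exp (-(n * (r - 2 * δ)))) := by
        refine add_le_add (hS₀.trans (ENNReal.ofReal_le_ofReal
          (mul_le_mul_of_nonneg_left (hexp c₁ (min_le_left _ _)) (by linarith))))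
          (Finset.sum_le_sum fun m _ => ?_)
        exact sum_likelihood_ratio_le _ _ _ fun y hy => (Finset.mem_filter.1 hy).2
      _ = _ := by
        rw [Finset.sum_const, Finset.card_univ, Fintype.card_fin, nsmul_eq_mul,
          ENNReal.ofReal_add (by positivity) (by positivity), ENNReal.ofReal_mul (p := (M : ℝ))
            M.cast_nonneg, ENNReal.ofReal_natCast]
  · rw [sum_codeOutput]
    refine (Finset.sum_le_sum fun m _ => mul_le_mul_right ?_ _).trans_eq
      (sum_inv_mul_const M _)
    -- A codeword far from `Q` is caught by the atypical set, a close one by its own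
    -- likelihood-ratio set.
    by_cases hm : ∃ b, n * η ≤ |∑ i, (W (f m i) b).toReal - n * (Q b).toReal|
    · refine (Finset.sum_le_sum_of_subset (Finset.compl_subset_compl.2
        Finset.subset_union_left)).trans ((hfar (f m) hm).trans (ENNReal.ofReal_le_ofReal
          (mul_le_mul_of_nonneg_left (hexp c₁ (min_le_left _ _)) (by linarith))))
    · push Not at hm
      have h3 := le_sum_of_type_close hr hn (f m) hm
      refine (Finset.sum_le_sum_of_subset (Finset.compl_subset_compl.2
        ((Finset.subset_biUnion_of_mem (fun m => T (f m)) (Finset.mem_univ m)).trans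
          Finset.subset_union_right))).trans ((h2 (f m) (r - 2 * δ) (by linarith)).trans
            (ENNReal.ofReal_le_ofReal ?_))
      calc _ ≤ _ := hexp c₂ (min_le_right _ _)
        _ ≤ _ := le_mul_of_one_le_left (Real.exp_nonneg _) hK

theorem tendsto_mul_exp_neg {c : ℝ} (hc : 0 < c) (K : ℝ) :
    Tendsto (fun n : ℕ => K * Real.exp (-(n * c))) atTop (𝓝 0) := by
  have := (Real.tendsto_exp_neg_atTop_nhds_zero.comp
    (tendsto_natCast_atTop_atTop.atTop_mul_const hc : Tendsto (fun n : ℕ => (n : ℝ) * c)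
      atTop atTop)).const_mul K
  simpa using this

theorem le_of_mem_renyiRates_of_neg {W : X → PMF Y} {Q : PMF Y} {r : ℝ}
    (hr : ∀ δ > 0, ∃ η > 0, ∀ t ∈ stdSimplex ℝ X,
      (∀ y, |∑ x, t x * (W x y).toReal - (Q y).toReal| < η) →
        r - δ ≤ ∑ x, t x * densityMean (W x) Q)
    {s R : ℝ} (hs : -1 < s) (hs0 : s < 0) (hR : R ∈ renyiRates s W Q) : r ≤ R := by
  classical
  by_contra! hlt
  obtain ⟨δ, hδ⟩ : ∃ δ, δ = (r - R) / 3 := ⟨_, rfl⟩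
  have hδ0 : 0 < δ := by rw [hδ]; linarith
  obtain ⟨η, hη, hrη⟩ := hr δ hδ0
  obtain ⟨c, hc, K, hK, hsep⟩ := exists_separating_set hδ0 hη hrη
  set κ := min c δ with hκ
  have hκ0 : 0 < κ := lt_min hc hδ0
  set K' := K + 2 with hK'
  -- Small enough that both exponents `-s(κ - ε)` and `(1 + s)κ + sε` are positive, so both Hölder
  -- terms beat `e^{snε}`.
  set ε := κ * (1 + s) / 2 with hε
  have hε0 : 0 < ε := by have : 0 < 1 + s := by linarith
                         positivity
  have h1 := tendsto_mul_exp_neg (show 0 < -s * (κ - ε) by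
    refine mul_pos (by linarith) ?_
    rw [hε]; nlinarith) (K' ^ (-s))
  have h2 := tendsto_mul_exp_neg (show 0 < (1 + s) * κ + s * ε by
    rw [hε]
    have : (1 + s) * κ + s * (κ * (1 + s) / 2) = κ * (1 + s) * (1 + s / 2) := by ring
    rw [this]
    exact mul_pos (mul_pos hκ0 (by linarith)) (by linarith)) (K' ^ (1 + s))
  have h3 := h1.add h2
  rw [add_zero] at h3
  obtain ⟨n, hn1, hn, k, PU, f, hf⟩ := ((h3.eventually_le_const one_pos).and
    (eventually_exists_lt hR hε0)).exists
  have hn0 : (0 : ℝ) ≤ n := n.cast_nonneg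
  set a := K' * Real.exp (-(n * κ)) with ha
  have ha0 : 0 ≤ a := by positivity
  -- The `2` in `K' = K + 2` absorbs the rounding bound `M ≤ 2 e^{nR}`.
  have hle : K * Real.exp (-(n * c)) + numMessages n R * Real.exp (-(n * (r - 2 * δ))) ≤ a := by
    have e1 : Real.exp (-(n * c)) ≤ Real.exp (-(n * κ)) :=
      Real.exp_le_exp.2 (neg_le_neg (mul_le_mul_of_nonneg_left (min_le_left _ _) hn0))
    have e2 : Real.exp (n * R) * Real.exp (-(n * (r - 2 * δ))) ≤ Real.exp (-(n * κ)) := by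
      rw [← Real.exp_add, Real.exp_le_exp]
      have : n * κ ≤ n * δ := mul_le_mul_of_nonneg_left (min_le_right _ _) hn0
      have h5 : n * R + -(n * (r - 2 * δ)) = -(n * δ) := by rw [hδ]; ring
      linarith
    have e3 := mul_le_mul_of_nonneg_right (numMessages_le (n := n) hR.1)
      (Real.exp_nonneg (-(n * (r - 2 * δ))))
    rw [ha, hK', add_mul]
    nlinarith
  have hF : ∀ u, renyiSum s (codeOutput W (f u)) (productPMF fun _ => Q) ≤
      ENNReal.ofReal (a ^ (-s) + a ^ (1 + s)) := by
    intro u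
    obtain ⟨G, hG1, hG2⟩ := hsep n hn (numMessages n R) (f u)
    have g1 := hG1.trans (ENNReal.ofReal_le_ofReal hle)
    have g2 : ∑ y ∈ Gᶜ, codeOutput W (f u) y ≤ ENNReal.ofReal a :=
      hG2.trans (ENNReal.ofReal_le_ofReal (by
        have : 0 ≤ (numMessages n R : ℝ) * Real.exp (-(n * (r - 2 * δ))) := by positivity
        linarith))
    rw [renyiSum, ← Finset.sum_add_sum_compl G, ENNReal.ofReal_add (by positivity) (by positivity),
      ← ENNReal.ofReal_rpow_of_nonneg ha0 (by linarith),
      ← ENNReal.ofReal_rpow_of_nonneg ha0 (by linarith)]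
    have hle1 : ∀ (P : PMF (Fin n → Y)) (S : Finset (Fin n → Y)), ∑ y ∈ S, P y ≤ 1 := fun P S =>
      (Finset.sum_le_sum_of_subset (Finset.subset_univ S)).trans_eq P.sum_coe
    refine add_le_add ((sum_rpow_mul_rpow_le hs hs0 _ _ G).trans ?_)
      ((sum_rpow_mul_rpow_le hs hs0 _ _ Gᶜ).trans ?_)
    · exact (mul_le_of_le_one_left zero_le (ENNReal.rpow_le_one (hle1 _ _) (by linarith))).trans
        (ENNReal.rpow_le_rpow g1 (by linarith))
    · exact (mul_le_of_le_one_right zero_le (ENNReal.rpow_le_one (hle1 _ _) (by linarith))).trans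
        (ENNReal.rpow_le_rpow g2 (by linarith))
  have hlow := lt_renyiSum_of_renyiDiv_lt hs0 hf
  rw [renyiSum_jointPMF hs] at hlow
  have hup : ∑ u, PU u * renyiSum s (codeOutput W (f u)) (productPMF fun _ => Q) ≤
      ENNReal.ofReal (a ^ (-s) + a ^ (1 + s)) := by
    refine (Finset.sum_le_sum fun u _ => mul_le_mul_right (hF u) _).trans_eq ?_
    rw [← Finset.sum_mul, PU.sum_coe, one_mul]
  have hcontra := (ENNReal.ofReal_lt_ofReal_iff_of_nonneg (Real.exp_nonneg _)).1
    (hlow.trans_le hup)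
  have hK'0 : 0 ≤ K' := by linarith
  rw [ha, Real.mul_rpow hK'0 (Real.exp_nonneg _), Real.mul_rpow hK'0 (Real.exp_nonneg _),
    ← Real.exp_mul, ← Real.exp_mul] at hcontra
  have hfin : K' ^ (-s) * Real.exp (-(n * κ) * -s) + K' ^ (1 + s) * Real.exp (-(n * κ) * (1 + s))
      = (K' ^ (-s) * Real.exp (-(n * (-s * (κ - ε)))) +
        K' ^ (1 + s) * Real.exp (-(n * ((1 + s) * κ + s * ε)))) * Real.exp (s * (n * ε)) := by
    rw [add_mul, mul_assoc, mul_assoc, ← Real.exp_add, ← Real.exp_add]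
    ring_nf
  rw [hfin] at hcontra
  have := mul_le_of_le_one_left (Real.exp_nonneg (s * (n * ε))) hn1
  linarith

end Converse

/-! ### Converse for orders above one -/

section ConverseAbove

theorem ENNReal.sum_rpow_le_rpow_sum {ι : Type*} (t : Finset ι) (a : ι → ℝ≥0∞) {p : ℝ}
    (hp : 1 ≤ p) : ∑ i ∈ t, a i ^ p ≤ (∑ i ∈ t, a i) ^ p := by
  classical
  induction t using Finset.induction_on with
  | empty => simp
  | insert i t hi ih =>
    rw [Finset.sum_insert hi, Finset.sum_insert hi]
    exact (add_le_add_right ih _).trans (ENNReal.add_rpow_le_rpow_add _ _ hp)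

/-- Either `p ≤ t q`, or `(p / (t q))^s ≥ 1` and the second term alone dominates `p`. Summed over a
set, this bounds its `P`-mass by its `Q`-mass and the Rényi sum. -/
theorem le_mul_add_rpow_mul {p q t : ℝ≥0∞} {s : ℝ} (hs : 0 < s) (hp : p ≠ ⊤) (hq : q ≠ ⊤)
    (ht : t ≠ ⊤) : p ≤ t * q + t ^ (-s) * (p ^ (1 + s) * q ^ (-s)) := by
  rcases le_or_gt p (t * q) with h | h
  · exact h.trans le_self_add
  have hp0 : p ≠ 0 := (zero_le.trans_lt h).ne'
  refine le_trans ?_ le_add_self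
  have e : t ^ (-s) * (p ^ (1 + s) * q ^ (-s)) = p * (p ^ s * (t * q) ^ (-s)) := by
    rw [ENNReal.mul_rpow_of_ne_top ht hq, ENNReal.rpow_add _ _ hp0 hp, ENNReal.rpow_one]
    ring
  rw [e]
  refine le_mul_of_one_le_right zero_le ?_
  rw [ENNReal.rpow_neg, ← div_eq_mul_inv, ENNReal.le_div_iff_mul_le
    (Or.inr (ENNReal.rpow_pos (pos_iff_ne_zero.2 hp0) hp).ne')
    (Or.inr (ENNReal.rpow_ne_top_of_nonneg hs.le hp)), one_mul]
  exact ENNReal.rpow_le_rpow h.le hs.le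

theorem sum_le_mul_add_renyiSum {A : Type w} [Fintype A] {s : ℝ} (hs : 0 < s) (P Q : PMF A)
    (S : Finset A) {t : ℝ≥0∞} (ht : t ≠ ⊤) :
    ∑ y ∈ S, P y ≤ t * ∑ y ∈ S, Q y + t ^ (-s) * renyiSum s P Q := by
  calc ∑ y ∈ S, P y ≤ ∑ y ∈ S, (t * Q y + t ^ (-s) * (P y ^ (1 + s) * Q y ^ (-s))) :=
        Finset.sum_le_sum fun y _ =>
          le_mul_add_rpow_mul hs (P.apply_ne_top y) (Q.apply_ne_top y) ht
    _ ≤ _ := by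
        rw [Finset.sum_add_distrib, ← Finset.mul_sum, ← Finset.mul_sum, renyiSum]
        gcongr
        exact Finset.subset_univ S

/-- Only an inequality, since without absolute continuity the right side is infinite while
`densityMGF` stays finite. -/
theorem ofReal_exp_mul_le_renyiSum {A : Type w} [Fintype A] {s : ℝ} (hs : 0 < s) (P Q : PMF A) :
    ENNReal.ofReal (Real.exp (s * (s⁻¹ * Real.log (densityMGF P Q s)))) ≤ renyiSum s P Q := by
  by_cases h : ∀ x, Q x = 0 → P x = 0
  · rw [renyiSum_eq_ofReal (by linarith) h, mul_inv_cancel_left₀ hs.ne',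
      Real.exp_log (densityMGF_pos _ _ _)]
  · rw [renyiSum_eq_top hs h]
    exact le_top

variable {X : Type u} {Y : Type v} [Fintype Y]

/-- Superadditivity of `t ↦ t^(1+s)` bounds the power of the mixture below by the sum of the powers
of its components. -/
theorem sum_exp_le_renyiSum_codeOutput {W : X → PMF Y} {Q : PMF Y} {s : ℝ} (hs : 0 < s) {n M : ℕ}
    [NeZero M] (f : Fin M → Fin n → X) (d : X → ℝ)
    (hd : ∀ x, ENNReal.ofReal (Real.exp (s * d x)) ≤ renyiSum s (W x) Q) :
    (M : ℝ≥0∞)⁻¹ ^ (1 + s) * ∑ m, ENNReal.ofReal (Real.exp (s * ∑ i, d (f m i))) ≤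
      renyiSum s (codeOutput W f) (productPMF fun _ => Q) := by
  calc _ ≤ (M : ℝ≥0∞)⁻¹ ^ (1 + s) * ∑ m, renyiSum s (productPMF fun i => W (f m i))
          (productPMF fun _ => Q) := by
        gcongr with m
        rw [renyiSum_productPMF (by linarith), Finset.mul_sum, Real.exp_sum,
          ENNReal.ofReal_prod_of_nonneg fun i _ => Real.exp_nonneg _]
        exact Finset.prod_le_prod' fun i _ => hd _
    _ ≤ _ := by
        simp only [renyiSum]
        rw [Finset.sum_comm, Finset.mul_sum]
        refine Finset.sum_le_sum fun y _ => ?_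
        rw [← Finset.sum_mul, ← mul_assoc, codeOutput_apply, ← Finset.mul_sum,
          ENNReal.mul_rpow_of_nonneg _ _ (by linarith : 0 ≤ 1 + s)]
        gcongr
        exact ENNReal.sum_rpow_le_rpow_sum _ _ (by linarith)

/-- If each codeword in `t` puts mass at least `3 / 4` on a set that has output probability at
most `1 / 4`, then at least half of the codewords are not in `t`. -/
theorem half_le_card_compl {W : X → PMF Y} {n M : ℕ} [NeZero M] (f : Fin M → Fin n → X)
    (S : Finset (Fin n → Y)) (t : Finset (Fin M))
    (hS : ∑ y ∈ S, codeOutput W f y ≤ ENNReal.ofReal (1 / 4))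
    (ht : ∀ m ∈ t, ENNReal.ofReal (3 / 4) ≤ ∑ y ∈ S, productPMF (fun i => W (f m i)) y) :
    (M : ℝ) / 2 ≤ (tᶜ.card : ℝ) := by
  have hM : (0 : ℝ) < M := by exact_mod_cast Nat.pos_of_ne_zero (NeZero.ne M)
  have h1 : ENNReal.ofReal (t.card * ((M : ℝ)⁻¹ * (3 / 4))) ≤ ENNReal.ofReal (1 / 4) := by
    refine le_trans ?_ hS
    rw [sum_codeOutput]
    calc ENNReal.ofReal (t.card * ((M : ℝ)⁻¹ * (3 / 4)))
        = ∑ _m ∈ t, (M : ℝ≥0∞)⁻¹ * ENNReal.ofReal (3 / 4) := by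
          rw [Finset.sum_const, nsmul_eq_mul, ENNReal.ofReal_mul (Nat.cast_nonneg _),
            ENNReal.ofReal_mul (inv_nonneg.2 hM.le), ENNReal.ofReal_natCast,
            ENNReal.ofReal_inv_of_pos hM, ENNReal.ofReal_natCast]
      _ ≤ ∑ m ∈ t, (M : ℝ≥0∞)⁻¹ * ∑ y ∈ S, productPMF (fun i => W (f m i)) y :=
          Finset.sum_le_sum fun m hm => mul_le_mul_right (ht m hm) _
      _ ≤ _ := Finset.sum_le_sum_of_subset (Finset.subset_univ t)
  rw [ENNReal.ofReal_le_ofReal_iff (by norm_num), ← mul_assoc, ← div_eq_mul_inv] at h1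
  have h2 : (t.card : ℝ) ≤ M / 3 := by
    have : (t.card : ℝ) / M ≤ 1 / 3 := by linarith
    rw [div_le_iff₀ hM] at this
    linarith
  have h3 : (t.card : ℝ) + tᶜ.card = M := by
    have := Finset.card_add_card_compl t
    rw [Fintype.card_fin] at this
    exact_mod_cast this
  linarith

variable [Fintype X]

theorem le_of_mem_renyiRates_of_pos {W : X → PMF Y} {Q : PMF Y} {s r R : ℝ} (hs : 0 < s)
    (hr : ∀ δ > 0, ∃ η > 0, ∀ t ∈ stdSimplex ℝ X,
      (∀ y, |∑ x, t x * (W x y).toReal - (Q y).toReal| < η) →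
        r - δ ≤ ∑ x, t x * (s⁻¹ * Real.log (densityMGF (W x) Q s)))
    (hR : R ∈ renyiRates s W Q) : r ≤ R := by
  classical
  by_contra! hlt
  obtain ⟨δ, hδ⟩ : ∃ δ, δ = (r - R) / 3 := ⟨_, rfl⟩
  have hδ0 : 0 < δ := by rw [hδ]; linarith
  obtain ⟨η, hη, hrη⟩ := hr δ hδ0
  set d : X → ℝ := fun x => s⁻¹ * Real.log (densityMGF (W x) Q s) with hd
  obtain ⟨c, hc, K, hK, hatyp⟩ := exists_atypical W Q hη
  -- `δ` serves the final rate comparison, `c / 4` the bound on the output mass of the atypical set.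
  set ε := min δ (c / 4) with hε
  have hε0 : 0 < ε := lt_min hδ0 (by positivity)
  have h1 := tendsto_mul_exp_neg hc K
  have h2 := (tendsto_mul_exp_neg (half_pos hc) K).add
    (tendsto_mul_exp_neg (show 0 < s * (c / 4) by positivity) 1)
  rw [add_zero] at h2
  have h3 := tendsto_mul_exp_neg (mul_pos hs hδ0) (2 * 2 ^ s)
  obtain ⟨n, hn1, hn2, hn3, hn, k, PU, f, hf⟩ := ((h1.eventually_le_const
    (show (0 : ℝ) < 1 / 4 by norm_num)).and ((h2.eventually_le_const
    (show (0 : ℝ) < 1 / 4 by norm_num)).and ((h3.eventually_lt_const one_pos).and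
      (eventually_exists_lt hR hε0)))).exists
  have hn0 : (0 : ℝ) ≤ n := n.cast_nonneg
  have hup := renyiSum_lt_of_renyiDiv_lt hs hf
  rw [renyiSum_jointPMF (by linarith)] at hup
  obtain ⟨u, hu⟩ : ∃ u, renyiSum s (codeOutput W (f u)) (productPMF fun _ => Q) <
      ENNReal.ofReal (Real.exp (s * (n * ε))) := by
    by_contra! hcon
    refine absurd hup (not_lt.2 ?_)
    calc _ = ∑ u, PU u * ENNReal.ofReal (Real.exp (s * (n * ε))) := by
          rw [← Finset.sum_mul, PU.sum_coe, one_mul]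
      _ ≤ _ := Finset.sum_le_sum fun u _ => mul_le_mul_right (hcon u) _
  obtain ⟨S, hS, hfar⟩ := hatyp n
  set t : Finset (Fin (numMessages n R)) := Finset.univ.filter fun m =>
    ∃ b, n * η ≤ |∑ i, (W (f u m i) b).toReal - n * (Q b).toReal| with ht
  have hPS : ∑ y ∈ S, codeOutput W (f u) y ≤ ENNReal.ofReal (1 / 4) := by
    have hT : (0 : ℝ) < Real.exp (n * (c / 2)) := Real.exp_pos _
    -- With threshold `e^{nc/2}` the `Q^n` part is at most `K e^{-nc/2}` and the Rényi part at most
    -- `e^{-snc/2 + snε} ≤ e^{-snc/4}`.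
    refine (sum_le_mul_add_renyiSum hs _ (productPMF fun _ => Q) S
      (t := ENNReal.ofReal (Real.exp (n * (c / 2)))) ENNReal.ofReal_ne_top).trans ?_
    refine le_trans ?_ (ENNReal.ofReal_le_ofReal hn2)
    rw [ENNReal.ofReal_add (by positivity) (by positivity), ENNReal.ofReal_rpow_of_pos hT]
    refine add_le_add ((mul_le_mul_right hS _).trans_eq ?_)
      ((mul_le_mul_right hu.le _).trans ?_)
    · rw [← ENNReal.ofReal_mul hT.le, mul_left_comm, ← Real.exp_add]
      ring_nf
    · rw [← ENNReal.ofReal_mul (by positivity), ← Real.exp_mul, ← Real.exp_add, one_mul]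
      refine ENNReal.ofReal_le_ofReal (Real.exp_le_exp.2 ?_)
      have : s * (n * ε) ≤ s * (n * (c / 4)) :=
        mul_le_mul_of_nonneg_left (mul_le_mul_of_nonneg_left (min_le_right _ _) hn0) hs.le
      linarith
  have hcard := half_le_card_compl (W := W) (f u) S t hPS fun m hm => by
    have h4 := (hfar (f u m) (Finset.mem_filter.1 hm).2).trans (ENNReal.ofReal_le_ofReal hn1)
    have h5 := Finset.sum_add_sum_compl S fun y => productPMF (fun i => W (f u m i)) y
    rw [PMF.sum_coe] at h5
    have h6 : (1 : ℝ≥0∞) ≤ ∑ y ∈ S, productPMF (fun i => W (f u m i)) y +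
        ENNReal.ofReal (1 / 4) := h5 ▸ add_le_add_right h4 _
    have h7 : ENNReal.ofReal (3 / 4) + ENNReal.ofReal (1 / 4) = 1 := by
      rw [← ENNReal.ofReal_add (by norm_num) (by norm_num)]
      norm_num
    rw [← h7] at h6
    exact (ENNReal.add_le_add_iff_right ENNReal.ofReal_ne_top).1 h6
  have hlow := (sum_exp_le_renyiSum_codeOutput hs (f u) d fun x =>
    ofReal_exp_mul_le_renyiSum hs (W x) Q).trans hu.le
  have hM0 : (0 : ℝ) < numMessages n R := (Real.exp_pos _).trans_le (exp_le_numMessages n R)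
  have hlow' : ENNReal.ofReal ((numMessages n R : ℝ)⁻¹ ^ (1 + s) * ((numMessages n R : ℝ) / 2 * Real.exp (s * (n * (r - δ))))) ≤
      ENNReal.ofReal (Real.exp (s * (n * ε))) := by
    refine le_trans ?_ hlow
    rw [ENNReal.ofReal_mul (by positivity), ← ENNReal.ofReal_rpow_of_pos (by positivity),
      ENNReal.ofReal_inv_of_pos hM0, ENNReal.ofReal_natCast]
    refine mul_le_mul_right ?_ _
    calc ENNReal.ofReal ((numMessages n R : ℝ) / 2 * Real.exp (s * (n * (r - δ))))
        ≤ ENNReal.ofReal (tᶜ.card * Real.exp (s * (n * (r - δ)))) :=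
          ENNReal.ofReal_le_ofReal (mul_le_mul_of_nonneg_right hcard (Real.exp_nonneg _))
      _ = ∑ _m ∈ tᶜ, ENNReal.ofReal (Real.exp (s * (n * (r - δ)))) := by
          rw [Finset.sum_const, nsmul_eq_mul, ENNReal.ofReal_mul (Nat.cast_nonneg _),
            ENNReal.ofReal_natCast]
      _ ≤ ∑ m ∈ tᶜ, ENNReal.ofReal (Real.exp (s * ∑ i, d (f u m i))) := by
          refine Finset.sum_le_sum fun m hm => ENNReal.ofReal_le_ofReal (Real.exp_le_exp.2
            (mul_le_mul_of_nonneg_left (le_sum_of_type_close hrη hn (f u m) ?_) hs.le))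
          simpa only [ht, Finset.mem_compl, Finset.mem_filter, Finset.mem_univ, true_and,
            not_exists, not_le] using hm
      _ ≤ _ := Finset.sum_le_sum_of_subset (Finset.subset_univ _)
  rw [ENNReal.ofReal_le_ofReal_iff (Real.exp_nonneg _)] at hlow'
  have e1 : (numMessages n R : ℝ)⁻¹ ^ (1 + s) * ((numMessages n R : ℝ) / 2 * Real.exp (s * (n * (r - δ)))) =
      ((numMessages n R : ℝ) ^ s)⁻¹ * Real.exp (s * (n * (r - δ))) / 2 := by
    rw [Real.rpow_add (inv_pos.2 hM0), Real.rpow_one, Real.inv_rpow hM0.le]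
    field_simp
  have e2 : (numMessages n R : ℝ) ^ s ≤ 2 ^ s * Real.exp (n * R * s) := by
    rw [Real.exp_mul, ← Real.mul_rpow zero_le_two (Real.exp_nonneg _)]
    exact Real.rpow_le_rpow hM0.le (numMessages_le hR.1) hs.le
  rw [e1, div_le_iff₀ two_pos, inv_mul_le_iff₀ (Real.rpow_pos_of_pos hM0 s)] at hlow'
  -- Since `r - δ = R + 2δ`, the right side falls short of the left by the factor `e^{-snδ}`, which
  -- eventually beats `2 * 2^s`.
  have e3 : Real.exp (s * (n * (r - δ))) ≤
      2 ^ s * Real.exp (n * R * s) * (Real.exp (s * (n * δ)) * 2) := by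
    refine hlow'.trans (mul_le_mul e2 (mul_le_mul_of_nonneg_right (Real.exp_le_exp.2
      (mul_le_mul_of_nonneg_left (mul_le_mul_of_nonneg_left (min_le_left _ _) hn0) hs.le))
      zero_le_two) (by positivity) (by positivity))
  have e4 : 2 ^ s * Real.exp (n * R * s) * (Real.exp (s * (n * δ)) * 2) =
      2 * 2 ^ s * Real.exp (-(n * (s * δ))) * Real.exp (s * (n * (r - δ))) := by
    have : r = R + 3 * δ := by rw [hδ]; ring
    rw [mul_assoc (2 * 2 ^ s), ← Real.exp_add, this]
    have : Real.exp (n * R * s) * Real.exp (s * (n * δ)) =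
        Real.exp (-(n * (s * δ)) + s * (n * (R + 3 * δ - δ))) := by
      rw [← Real.exp_add]
      ring_nf
    rw [← this]
    ring
  rw [e4] at e3
  have := mul_lt_mul_of_pos_right hn3 (Real.exp_pos (s * (n * (r - δ))))
  linarith

end ConverseAbove

/-! ### Order zero -/

section OrderZero

/-- With `0 ^ 0 = 1` the sum is the total mass of `Q`. -/
theorem renyiDiv_neg_one {A : Type w} [Fintype A] (P Q : PMF A) : renyiDiv (-1) P Q = 0 := by
  rw [renyiDiv_of_ne_zero (by norm_num), renyiSum]
  simp [Q.sum_coe]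

theorem suppDivZero_nonneg {A : Type w} [Fintype A] (P Q : PMF A) : 0 ≤ suppDivZero P Q := by
  rw [suppDivZero, EReal.neg_nonneg, ENNReal.log_le_zero_iff]
  exact (Finset.sum_le_sum_of_subset (Finset.subset_univ _)).trans_eq Q.sum_coe

theorem suppDivZero_eq_zero {A : Type w} [Fintype A] {P Q : PMF A} (h : ∀ x, P x = 0 → Q x = 0) :
    suppDivZero P Q = 0 := by
  classical
  rw [suppDivZero, Finset.sum_filter_of_ne (p := fun x => P x ≠ 0) fun x _ hx hP => hx (h x hP),
    Q.sum_coe, ENNReal.log_one, neg_zero]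

variable {X : Type u} {Y : Type v} [Fintype Y]

theorem isGLB_zero_of_forall_mem {S : Set ℝ} (h : ∀ R, R ∈ S ↔ 0 < R) : IsGLB S 0 := by
  rw [show S = Set.Ioi 0 from Set.ext h]
  exact isGLB_Ioi

theorem isGLB_renyiRates_neg_one [Nonempty X] (W : X → PMF Y) (Q : PMF Y) :
    IsGLB (renyiRates (-1) W Q) 0 := by
  refine isGLB_zero_of_forall_mem fun R => ⟨fun h => h.1, fun hR => ?_⟩
  refine mem_vanishingRates_of_le (fun A _ P P' => (renyiDiv_neg_one P P').ge) hR 0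
    (Eventually.of_forall fun n => ?_)
  refine (optimalDiscrepancy_le _ (PMF.pure (0 : Fin 1))
    fun _ _ _ => Classical.arbitrary X).trans_eq ?_
  rw [renyiDiv_neg_one, EReal.coe_zero]

theorem isGLB_suppRates_of_exists {W : X → PMF Y} {Q : PMF Y} (h : ∃ x, ∀ y, W x y = 0 → Q y = 0) :
    IsGLB (vanishingRates (fun _ _ P P' => suppDivZero P P') W Q) 0 := by
  obtain ⟨x, hx⟩ := h
  refine isGLB_zero_of_forall_mem fun R => ⟨fun h => h.1, fun hR => ?_⟩
  refine mem_vanishingRates_of_le (fun A _ P P' => suppDivZero_nonneg P P') hR 0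
    (Eventually.of_forall fun n => ?_)
  refine (optimalDiscrepancy_le _ (PMF.pure (0 : Fin 1)) fun _ _ _ => x).trans_eq ?_
  rw [suppDivZero_eq_zero, EReal.coe_zero]
  rintro ⟨u, y⟩ hy
  rw [jointPMF_apply, mul_eq_zero] at hy ⊢
  refine hy.imp_right fun hy => ?_
  rw [codeOutput_apply, sum_inv_mul_const, productPMF_apply, Finset.prod_eq_zero_iff] at hy
  obtain ⟨i, hi, hi0⟩ := hy
  exact Finset.prod_eq_zero hi (hx _ hi0)

open Classical in
-- The output support is the union of the codewords' supports, each a product set of `Q^n`-mass at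
-- most `a ^ n`.
theorem sum_support_codeOutput_le {W : X → PMF Y} {Q : PMF Y} {a : ℝ≥0∞}
    (ha : ∀ x, ∑ y with W x y ≠ 0, Q y ≤ a) {n M : ℕ} [NeZero M] (f : Fin M → Fin n → X) :
    ∑ y with codeOutput W f y ≠ 0, productPMF (fun _ => Q) y ≤ M * a ^ n := by
  calc _ ≤ ∑ m : Fin M, ∑ y with productPMF (fun i => W (f m i)) y ≠ 0,
          productPMF (fun _ => Q) y := by
        refine ENNReal.sum_le_sum_sum (fun y hy => ?_) _
        rw [Finset.mem_filter, codeOutput_apply] at hy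
        obtain ⟨m, hm, hm0⟩ := Finset.exists_ne_zero_of_sum_ne_zero hy.2
        exact ⟨m, hm, Finset.mem_filter.2 ⟨Finset.mem_univ y, right_ne_zero_of_mul hm0⟩⟩
    _ ≤ ∑ _m : Fin M, a ^ n := by
        refine Finset.sum_le_sum fun m _ => ?_
        calc _ = ∑ y : Fin n → Y, ∏ i, if W (f m i) (y i) ≠ 0 then Q (y i) else 0 := by
              rw [Finset.sum_filter]
              refine Finset.sum_congr rfl fun y _ => ?_
              simp only [productPMF_apply, Finset.prod_ne_zero_iff]
              split_ifs with h
              · exact Finset.prod_congr rfl fun i hi => (if_pos (h i hi)).symm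
              · push Not at h
                obtain ⟨i, hi, hi0⟩ := h
                exact (Finset.prod_eq_zero hi (if_neg (not_not.2 hi0))).symm
          _ = ∏ i, ∑ y with W (f m i) y ≠ 0, Q y := by
              rw [Fintype.sum_prod_fin fun i y => if W (f m i) y ≠ 0 then Q y else 0]
              simp only [Finset.sum_filter]
          _ ≤ ∏ _i : Fin n, a := Finset.prod_le_prod' fun i _ => ha _
          _ = a ^ n := by simp
    _ = _ := by simp

theorem exists_of_isGLB_suppRates [Finite X] [Nonempty X] {W : X → PMF Y} {Q : PMF Y}
    (h : IsGLB (vanishingRates (fun _ _ P P' => suppDivZero P P') W Q) 0) :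
    ∃ x, ∀ y, W x y = 0 → Q y = 0 := by
  classical
  by_contra! hcon
  set q : X → ℝ≥0∞ := fun x => ∑ y with W x y ≠ 0, Q y with hq
  have hq1 : ∀ x, q x < 1 := fun x => by
    obtain ⟨y, hWy, hQy⟩ := hcon x
    have h1 := Finset.sum_filter_add_sum_filter_not Finset.univ (fun y => W x y ≠ 0) Q
    rw [Q.sum_coe] at h1
    have hne : q x ≠ ⊤ := ENNReal.sum_ne_top.2 fun y _ => Q.apply_ne_top y
    rw [← h1]
    refine ENNReal.lt_add_right hne fun h0 => hQy ?_
    exact Finset.sum_eq_zero_iff.1 h0 y (by simpa using hWy)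
  obtain ⟨x₀, hx₀⟩ := Finite.exists_max q
  -- Then `q x₀ = 1 - b ≤ e^{-b}`, so rates below `b` cannot cover `Q^n`.
  obtain ⟨b, hb⟩ : ∃ b, b = 1 - (q x₀).toReal := ⟨_, rfl⟩
  have hb0 : 0 < b := by
    have := (ENNReal.toReal_lt_toReal (hq1 x₀).ne_top ENNReal.one_ne_top).2 (hq1 x₀)
    rw [ENNReal.toReal_one] at this
    linarith
  have hqb : ∀ x, q x ≤ ENNReal.ofReal (Real.exp (-b)) := fun x => by
    refine (hx₀ x).trans (ENNReal.le_ofReal_iff_toReal_le (hq1 x₀).ne_top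
      (Real.exp_nonneg _) |>.2 ?_)
    have := Real.add_one_le_exp (-b)
    linarith
  obtain ⟨R, hR, hRb⟩ := (isGLB_lt_iff h).1 hb0
  -- Half of the gap: the covered mass is at most `2 e^{-2nε}`, and one factor `e^{-nε}` absorbs the
  -- 2.
  obtain ⟨ε, hε⟩ : ∃ ε, ε = (b - R) / 2 := ⟨_, rfl⟩
  have hε0 : 0 < ε := by rw [hε]; linarith
  obtain ⟨n, hn1, hn, k, PU, f, hf⟩ := (((tendsto_mul_exp_neg hε0 2).eventually_lt_const
    one_pos).and (eventually_exists_lt hR hε0)).exists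
  rw [suppDivZero, EReal.neg_lt_comm, ← EReal.coe_neg,
    ← Real.log_exp (-(n * ε)), ← ENNReal.log_ofReal_of_pos (Real.exp_pos _),
    ENNReal.log_lt_log_iff] at hf
  refine absurd hf (not_lt.2 ?_)
  calc _ ≤ ∑ u, PU u * ∑ y with codeOutput W (f u) y ≠ 0, productPMF (fun _ => Q) y := by
        rw [Finset.sum_filter, Fintype.sum_prod_type]
        refine Finset.sum_le_sum fun u _ => ?_
        rw [Finset.sum_filter, Finset.mul_sum]
        refine Finset.sum_le_sum fun y _ => ?_
        rw [jointPMF_apply, jointPMF_apply]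
        by_cases hy : codeOutput W (f u) y = 0
        · simp [hy]
        · rw [if_pos hy]
          split_ifs
          exacts [le_rfl, zero_le]
    _ ≤ ∑ u, PU u * (numMessages n R * ENNReal.ofReal (Real.exp (-b)) ^ n) :=
        Finset.sum_le_sum fun u _ =>
          mul_le_mul_right (sum_support_codeOutput_le hqb (f u)) _
    _ = ENNReal.ofReal (numMessages n R * Real.exp (-(n * b))) := by
        rw [← Finset.sum_mul, PU.sum_coe, one_mul, ENNReal.ofReal_mul (Nat.cast_nonneg _),
          ENNReal.ofReal_natCast, ← ENNReal.ofReal_pow (Real.exp_nonneg _), ← Real.exp_nat_mul,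
          mul_neg]
    _ ≤ ENNReal.ofReal (Real.exp (-(n * ε))) := ENNReal.ofReal_le_ofReal (by
        have h1 := mul_le_mul_of_nonneg_right (numMessages_le (n := n) hR.1)
          (Real.exp_nonneg (-(n * b)))
        have h2 : 2 * Real.exp (n * R) * Real.exp (-(n * b)) =
            2 * Real.exp (-(n * ε)) * Real.exp (-(n * ε)) := by
          rw [mul_assoc, mul_assoc, ← Real.exp_add, ← Real.exp_add, hε]
          ring_nf
        rw [h2] at h1
        exact h1.trans (mul_le_of_le_one_left (Real.exp_nonneg _) hn1.le))

end OrderZero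

/-! ### Single-letter quantities -/

section SingleLetter

variable {X : Type u} {Y : Type v} [Fintype X] [Fintype Y]

/-- Letters of zero probability contribute `0 * ∞ = 0`, so `d` may be arbitrary there. -/
theorem condRenyiDiv_eq_coe {s : ℝ} {W : X → PMF Y} {Q : PMF Y} {P : PMF X} {d : X → ℝ}
    (h : ∀ x, P x ≠ 0 → renyiDiv s (W x) Q = (d x : EReal)) :
    condRenyiDiv s W Q P = ((∑ x, (P x).toReal * d x : ℝ) : EReal) := by
  rw [condRenyiDiv, EReal.coe_finset_sum]
  refine Finset.sum_congr rfl fun x _ => ?_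
  by_cases hx : P x = 0
  · simp [hx]
  · rw [h x hx, PMF.coe_ereal_apply, EReal.coe_mul]

theorem mutualInformation_eq_coe {W : X → PMF Y} {Q : PMF Y} {P : PMF X}
    (hP : P ∈ inputDists W Q) :
    mutualInformation W P = ((∑ x, (P x).toReal * densityMean (W x) Q : ℝ) : EReal) := by
  rw [mutualInformation, show P.bind W = Q from hP, relEntropy_eq_coe, densityMean,
    Fintype.sum_prod_type]
  · congr 1
    refine Finset.sum_congr rfl fun x _ => ?_
    rw [densityMean, Finset.mul_sum]
    refine Finset.sum_congr rfl fun y _ => ?_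
    rw [jointPMF_apply, jointPMF_apply, ENNReal.toReal_mul, ENNReal.toReal_mul, mul_assoc]
    by_cases hx : (P x).toReal = 0
    · simp [hx]
    · rw [mul_div_mul_left _ _ hx]
  · rintro ⟨x, y⟩ hxy
    rw [jointPMF_apply, mul_eq_zero] at hxy ⊢
    by_cases hx : P x = 0
    · exact Or.inl hx
    · exact Or.inr (channel_eq_zero hP hx (hxy.resolve_left hx))

omit [Fintype Y] in
theorem isLeast_image_coe {F : PMF X → EReal} {W : X → PMF Y} {Q : PMF Y} {d : X → ℝ} {r : ℝ}
    (hF : ∀ P ∈ inputDists W Q, F P = ((∑ x, (P x).toReal * d x : ℝ) : EReal))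
    (hr : ∃ P ∈ inputDists W Q, ∑ x, (P x).toReal * d x = r)
    (hmin : ∀ P ∈ inputDists W Q, r ≤ ∑ x, (P x).toReal * d x) :
    IsLeast (F '' inputDists W Q) (r : EReal) := by
  obtain ⟨P, hP, hPr⟩ := hr
  refine ⟨⟨P, hP, by rw [hF P hP, hPr]⟩, ?_⟩
  rintro _ ⟨P', hP', rfl⟩
  rw [hF P' hP', EReal.coe_le_coe_iff]
  exact hmin P' hP'

theorem sum_mul_nonneg {s : ℝ} (hs : -1 < s) {W : X → PMF Y} {Q : PMF Y} {P : PMF X} {d : X → ℝ}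
    (h : ∀ x, P x ≠ 0 → renyiDiv s (W x) Q = (d x : EReal)) :
    0 ≤ ∑ x, (P x).toReal * d x := by
  refine Finset.sum_nonneg fun x _ => ?_
  by_cases hx : P x = 0
  · simp [hx]
  · have := renyiDiv_nonneg hs (W x) Q
    rw [h x hx] at this
    exact mul_nonneg ENNReal.toReal_nonneg (EReal.coe_nonneg.1 this)

theorem isGLB_of_forall_lt_mem {S : Set ℝ} {r : ℝ} (h1 : ∀ R ∈ S, r ≤ R) (h2 : ∀ R, r < R → R ∈ S) :
    IsGLB S r :=
  ⟨h1, fun _ hb => le_of_forall_gt_imp_ge_of_dense fun R hR => hb (h2 R hR)⟩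

end SingleLetter

end

/-! ### The resolvability theorem -/

theorem theorem3 {X Y : Type*} [Fintype X] [Fintype Y]
    (W : X → PMF Y) (Q : PMF Y) (hne : (inputDists W Q).Nonempty)
    (s : ℝ) (hs : s ∈ Set.Icc (-1 : ℝ) 1) :
    (0 < s → ∃ r : ℝ, IsGLB (renyiRates s W Q) r ∧
      IsLeast (condRenyiDiv s W Q '' inputDists W Q) (r : EReal)) ∧
    (-1 < s → s ≤ 0 → ∃ r : ℝ, IsGLB (renyiRates s W Q) r ∧
      IsLeast (condRenyiDiv 0 W Q '' inputDists W Q) (r : EReal) ∧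
      IsLeast (mutualInformation W '' inputDists W Q) (r : EReal)) ∧
    (s = -1 → IsGLB (renyiRates s W Q) 0 ∧
      (IsGLB (vanishingRates (fun _ _ P P' => suppDivZero P P') W Q) 0 ↔
        ∃ x, ∀ y, W x y = 0 → Q y = 0)) := by
  refine ⟨fun hs0 => ?_, fun hs1 hs0 => ?_, fun hs1 => ?_⟩
  · obtain ⟨r, hr, hmin, hclose⟩ := exists_min_linear W Q hne
      fun x => s⁻¹ * Real.log (densityMGF (W x) Q s)
    have hd : ∀ P ∈ inputDists W Q, ∀ x, P x ≠ 0 → renyiDiv s (W x) Q =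
        ((s⁻¹ * Real.log (densityMGF (W x) Q s) : ℝ) : EReal) := fun P hP x hx =>
      renyiDiv_eq_coe (by linarith) hs0.ne' fun y hy => channel_eq_zero hP hx hy
    refine ⟨r, ?_, isLeast_image_coe (fun P hP => condRenyiDiv_eq_coe (hd P hP)) hr hmin⟩
    obtain ⟨P, hP, hPr⟩ := hr
    -- Needed because rates are positive: every `R > r` is then admissible.
    have hr0 : 0 ≤ r := hPr ▸ sum_mul_nonneg (by linarith) (hd P hP)
    exact isGLB_of_forall_lt_mem (fun R hR => le_of_mem_renyiRates_of_pos hs0 hclose hR)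
      fun R hR => mem_renyiRates_of_lt hP hs0 hs.2 (hr0.trans_lt hR) (hPr.trans_lt hR)
  · obtain ⟨r, hr, hmin, hclose⟩ := exists_min_linear W Q hne fun x => densityMean (W x) Q
    have hd : ∀ P ∈ inputDists W Q, ∀ x, P x ≠ 0 → renyiDiv 0 (W x) Q =
        (densityMean (W x) Q : EReal) := fun P hP x hx => by
      rw [renyiDiv_zero]
      exact relEntropy_eq_coe fun y hy => channel_eq_zero hP hx hy
    refine ⟨r, ?_, isLeast_image_coe (fun P hP => condRenyiDiv_eq_coe (hd P hP)) hr hmin,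
      isLeast_image_coe (fun P hP => mutualInformation_eq_coe hP) hr hmin⟩
    obtain ⟨P, hP, hPr⟩ := hr
    have hr0 : 0 ≤ r := hPr ▸ sum_mul_nonneg (by norm_num) (hd P hP)
    refine isGLB_of_forall_lt_mem (fun R hR => ?_) fun R hR =>
      renyiRates_zero_subset hs1 hs0 W Q
        (mem_renyiRates_zero_of_lt hP (hr0.trans_lt hR) (hPr.trans_lt hR))
    rcases hs0.eq_or_lt with rfl | hs0
    -- At order one the converse is inherited from `s = -1/2`, whose divergence is smaller and whose
    -- threshold is the same.
    · exact le_of_mem_renyiRates_of_neg (s := -1 / 2) hclose (by norm_num) (by norm_num)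
        (renyiRates_zero_subset (by norm_num) (by norm_num) W Q hR)
    · exact le_of_mem_renyiRates_of_neg hclose hs1 hs0 hR
  · subst hs1
    obtain ⟨P, -⟩ := hne
    have : Nonempty X := ⟨P.support_nonempty.some⟩
    exact ⟨isGLB_renyiRates_neg_one W Q, exists_of_isGLB_suppRates, isGLB_suppRates_of_exists⟩
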